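/- Let $V$ be a finite alphabet and let $\$\notin V$ be an end-of-string symbol. A weighted language is a function $\tilde p:V^*\to\mathbb{R}_{\ge 0}$. It is normalizable if $Z=\sum_{x\in V^*}\tilde p(x)$ is finite and strictly positive; its normalized version is then $p=\tilde p/Z$. For $\hat x\in V^*$ let $Z(\hat x)$ be the sum of $\tilde p(x)$ over all $x\in V^*$ that have $\hat x$ as a prefix. If $Z(\hat x)>0$, the local conditional probabilities are $p(v\mid\hat x)=Z(\hat x v)/Z(\hat x)$ for $v\in V$, and $p(\$\mid\hat x)=1-\sum_{v\in V}p(v\mid\hat x)$. A parametric model is a Turing machine $M$ that reads a bit string $\theta$ and outputs the description of a Turing machine $M(\theta)$. Turing machines are deterministic, with a fixed finite number of tapes and a fixed finite tape alphabet (the machines constructed by one model $M$ have the same number of tapes and the same alphabet), and output rational numbers as fractions of two binary numerals. A weighted language $r$ is efficiently computable with compact parameters if there are a parametric model $M$ and bit strings $(\theta_n)_{n\in\mathbb{N}}$ such that, with $r_n=M(\theta_n)$: $|\theta_n|=O(\mathrm{poly}(n))$; $M$ constructs $r_n$ from $\theta_n$ in time $O(\mathrm{poly}(n))$; and for every $x\in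 V^*$ of length $n$, $r_n$ on input $x$ outputs $r(x)$ in time $O(\mathrm{poly}(n))$. A parametric model $M^{\mathrm q}$ efficiently locally normalizes $\tilde p$ with compact parameters $(\theta_n)_{n\in\mathbb{N}}$ if $\tilde p$ is normalizable and, with $q_n=M^{\mathrm q}(\theta_n)$: $q_n$ on input $\hat x s$ outputs $p(s\mid\hat x)$ for all $s\in V\cup\{\$\}$ and all $\hat x\in V^*$ with $|\hat x|\le n$ and $Z(\hat x)>0$; $|\theta_n|=O(\mathrm{poly}(n))$; $M^{\mathrm q}$ constructs $q_n$ from $\theta_n$ in time $O(\mathrm{poly}(n))$; and the running time of $q_n$ on all inputs $\hat x s$ with $\hat x\in V^*$, $|\hat x|\le n$, $s\in V\cup\{\$\}$ is $O(\mathrm{poly}(n))$. Lemma. Let $M^{\mathrm q}$ be a Turing machine that efficiently locally normalizes a weighted language $\tilde p$ with compact parameters $(\theta_n)_{n\in\mathbb{N}}$. Then $p=\tilde p/Z$ is efficiently computable with compact parameters. -/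

import Mathlib

open scoped NNReal

noncomputable section

namespace SeqModel

/-! ### Multitape Turing machines -/

/-- One entry of the transition table of a Turing machine with `k + 1` tapes over the tape
alphabet `Γ`: in state `src`, when the scanned symbols are `read`, go to state `tgt`, write the
symbols `write`, and then move each head (`none` means that the head stays). -/
structure Rule (k : ℕ) (Γ : Type*) where
  src : ℕ
  read : Fin (k + 1) → Γ
  tgt : ℕ
  write : Fin (k + 1) → Γ
  move : Fin (k + 1) → Option Turing.Dir

/-- A deterministic Turing machine with `k + 1` two-way infinite tapes, given by its finite
transition table (the first applicable entry is used). States are natural numbers; `0` is the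
initial state and `1` is the halting state. -/
structure TM (k : ℕ) (Γ : Type*) where
  rules : List (Rule k Γ)

/-- A configuration: the state, and the tapes with their head positions. The blank symbol is
the default element of `Γ`. -/
structure Cfg (k : ℕ) (Γ : Type*) [Inhabited Γ] where
  state : ℕ
  tape : Fin (k + 1) → Turing.Tape Γ

namespace TM

variable {k : ℕ} {Γ : Type*} [Inhabited Γ]

/-- The effect of a transition on one tape. -/
def act (T : Turing.Tape Γ) (a : Γ) (d : Option Turing.Dir) : Turing.Tape Γ :=
  match d with
  | none => T.write a
  | some d => (T.write a).move d

open Classical in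
/-- One step. A configuration in the halting state does not change any more. If no table entry
applies in another state, then the machine is stuck there forever (and does not halt). -/
def step (M : TM k Γ) (c : Cfg k Γ) : Cfg k Γ :=
  if c.state = 1 then c
  else
    match M.rules.find? (fun r => decide (r.src = c.state ∧ r.read = fun i => (c.tape i).head)) with
    | none => c
    | some r => ⟨r.tgt, fun i => act (c.tape i) (r.write i) (r.move i)⟩

/-- The initial configuration: the input is on tape `0`, with the head on its first symbol, and
the other tapes are blank. -/
def init (k : ℕ) (input : List Γ) : Cfg k Γ :=
  ⟨0, fun i => if i = 0 then Turing.Tape.mk₁ input else Turing.Tape.mk₁ []⟩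

/-- The configuration after `t` steps. -/
def run (M : TM k Γ) (input : List Γ) (t : ℕ) : Cfg k Γ :=
  M.step^[t] (init k input)

/-- `M` halts on `input` after at most `t` steps. -/
def HaltsWithin (M : TM k Γ) (input : List Γ) (t : ℕ) : Prop :=
  (M.run input t).state = 1

/-- `M` halts on `input` after at most `t` steps with output `w`: from the head of tape `0`
rightwards, that tape holds `w`, followed by blanks only. -/
def OutputsWithin (M : TM k Γ) (input w : List Γ) (t : ℕ) : Prop :=
  M.HaltsWithin input t ∧
    ((M.run input t).tape 0).right₀ = Turing.ListBlank.mk w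

/-- `M` halts on `input` with output `w`. -/
def Outputs (M : TM k Γ) (input w : List Γ) : Prop :=
  ∃ t, M.OutputsWithin input w t

end TM

/-! ### Tape alphabet, strings and rational numbers on tapes, descriptions of machines -/

/-- The tape alphabet of machines that handle strings over `V`: a blank, the bits, a fraction
bar, the end-of-string symbol, the symbols of `V`, and `g` auxiliary symbols. -/
inductive Sym (V : Type*) (g : ℕ) where
  | blank
  | bit (b : Bool)
  | slash
  | eos
  | letter (v : V)
  | aux (i : Fin g)

instance (V : Type*) (g : ℕ) : Inhabited (Sym V g) := ⟨Sym.blank⟩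

/-- A numbering of the tape alphabet. -/
def Sym.code {V : Type*} [Fintype V] {g : ℕ} : Sym V g → ℕ
  | blank => 0
  | bit false => 1
  | bit true => 2
  | slash => 3
  | eos => 4
  | letter v => 5 + (Fintype.equivFin V v : ℕ)
  | aux i => 5 + Fintype.card V + (i : ℕ)

/-- A bit string as a tape word. -/
def bitWord (V : Type*) (g : ℕ) (w : List Bool) : List (Sym V g) :=
  w.map Sym.bit

/-- A string over `V` as a tape word. -/
def strWord {V : Type*} (g : ℕ) (x : List V) : List (Sym V g) :=
  x.map Sym.letter

/-- A symbol of `V ∪ {$}` as a tape symbol, where `none` stands for `$`. -/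
def nextSym {V : Type*} (g : ℕ) : Option V → Sym V g
  | none => Sym.eos
  | some v => Sym.letter v

/-- The number written in binary by `w`, least significant bit first. -/
def binVal (w : List Bool) : ℕ :=
  Nat.ofDigits 2 (w.map Bool.toNat)

/-- The machine `M` halts on `input` with output a fraction `a/b` of two binary numerals,
not necessarily in lowest terms, whose value is `r`. -/
def OutputsRat {V : Type*} {g k : ℕ} (M : TM k (Sym V g)) (input : List (Sym V g)) (r : ℝ) :
    Prop :=
  ∃ a b : List Bool, binVal b ≠ 0 ∧ r = (binVal a : ℝ) / (binVal b : ℝ) ∧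
    M.Outputs input (bitWord V g a ++ Sym.slash :: bitWord V g b)

/-- The self-delimiting code `1…10` of a natural number. -/
def encNat (n : ℕ) : List Bool :=
  List.replicate n true ++ [false]

/-- The code of a head movement. -/
def encMove : Option Turing.Dir → List Bool
  | none => encNat 0
  | some Turing.Dir.left => encNat 1
  | some Turing.Dir.right => encNat 2

/-- The code of one entry of a transition table. -/
def Rule.encode {V : Type*} [Fintype V] {g k : ℕ} (r : Rule k (Sym V g)) : List Bool :=
  encNat r.src ++ (List.ofFn fun i => encNat (r.read i).code).flatten ++
    encNat r.tgt ++ (List.ofFn fun i => encNat (r.write i).code ++ encMove (r.move i)).flatten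

/-- The description of a Turing machine as a bit string: the codes of the entries of its
transition table one after the other. -/
def TM.encode {V : Type*} [Fintype V] {g k : ℕ} (M : TM k (Sym V g)) : List Bool :=
  M.rules.flatMap Rule.encode

/-! ### Weighted languages -/

/-- A weighted language over `V`. -/
abbrev WeightedLanguage (V : Type*) := List V → ℝ≥0

namespace WeightedLanguage

variable {V : Type*}

/-- The global normalizing constant. -/
def Z (p : WeightedLanguage V) : ℝ≥0 :=
  ∑' x, p x

/-- The global normalizing constant is finite and strictly positive. -/
def Normalizable (p : WeightedLanguage V) : Prop :=
  Summable p ∧ 0 < p.Z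

/-- The normalized version of a weighted language. -/
def normalized (p : WeightedLanguage V) : WeightedLanguage V :=
  fun x => p x / p.Z

/-- The total weight of the strings with prefix `y`. -/
def prefixZ (p : WeightedLanguage V) (y : List V) : ℝ≥0 :=
  ∑' x : {x : List V // y <+: x}, p x

/-- The local conditional probability of a next symbol in `V ∪ {$}` (where `none` stands for
`$`) after the prefix `y`; it is meaningful if `0 < p.prefixZ y`. -/
def localProb [Fintype V] (p : WeightedLanguage V) (y : List V) : Option V → ℝ
  | some v => (p.prefixZ (y ++ [v]) : ℝ) / (p.prefixZ y : ℝ)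
  | none => 1 - ∑ v, (p.prefixZ (y ++ [v]) : ℝ) / (p.prefixZ y : ℝ)

end WeightedLanguage

/-! ### Parametric models and compact parameters -/

/-- A general-purpose Turing machine `machine` that reads parameters (a bit string) and writes the
description of a specialized Turing machine with `outTapes + 1` tapes. Both kinds of machines use
a tape alphabet with `numAux` auxiliary symbols. -/
structure ParametricModel (V : Type*) where
  numAux : ℕ
  tapes : ℕ
  outTapes : ℕ
  machine : TM tapes (Sym V numAux)

namespace ParametricModel

variable {V : Type*} [Fintype V]

/-- The specialized machines that a parametric model constructs. -/
abbrev Specialized (M : ParametricModel V) : Type _ :=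
  TM M.outTapes (Sym V M.numAux)

/-- From the parameters `θ`, the model constructs the specialized machine `q` in at most `t`
steps. -/
def ConstructsWithin (M : ParametricModel V) (θ : List Bool) (q : M.Specialized) (t : ℕ) : Prop :=
  M.machine.OutputsWithin (bitWord V M.numAux θ) (bitWord V M.numAux q.encode) t

/-- The model `M` with the parameters `θ 0, θ 1, …` computes the weighted language `p`
efficiently, and the parameters are compact: all of the parameter size, the time to construct the
`n`-th specialized machine `q n`, and the time of `q n` on strings of length `n` are `O(poly n)`. -/
def EfficientlyComputes (M : ParametricModel V) (θ : ℕ → List Bool) (p : WeightedLanguage V) :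
    Prop :=
  ∃ q : ℕ → M.Specialized,
    (∃ P : Polynomial ℕ, ∀ n, (θ n).length ≤ P.eval n) ∧
    (∃ P : Polynomial ℕ, ∀ n, M.ConstructsWithin (θ n) (q n) (P.eval n)) ∧
    (∀ x : List V, OutputsRat (q x.length) (strWord M.numAux x) (p x : ℝ)) ∧
    (∃ P : Polynomial ℕ, ∀ x : List V,
      (q x.length).HaltsWithin (strWord M.numAux x) (P.eval x.length))

/-- The model `M` efficiently locally normalizes `p` with compact parameters `θ 0, θ 1, …`.
The specialized machine `q n` has to give the local conditional probabilities after all prefixes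
of length at most `n` after which they are defined, and to respect its time bound after all
prefixes of length at most `n`. -/
def EfficientlyLocallyNormalizes (M : ParametricModel V) (θ : ℕ → List Bool)
    (p : WeightedLanguage V) : Prop :=
  p.Normalizable ∧
  ∃ q : ℕ → M.Specialized,
    (∀ (n : ℕ) (y : List V) (s : Option V), y.length ≤ n → 0 < p.prefixZ y →
      OutputsRat (q n) (strWord M.numAux y ++ [nextSym M.numAux s]) (p.localProb y s)) ∧
    (∃ P : Polynomial ℕ, ∀ n, (θ n).length ≤ P.eval n) ∧
    (∃ P : Polynomial ℕ, ∀ n, M.ConstructsWithin (θ n) (q n) (P.eval n)) ∧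
    (∃ P : Polynomial ℕ, ∀ (n : ℕ) (y : List V) (s : Option V), y.length ≤ n →
      (q n).HaltsWithin (strWord M.numAux y ++ [nextSym M.numAux s]) (P.eval n))

end ParametricModel

/-- The weighted language `p` is efficiently computable with compact parameters. -/
def EfficientlyComputableWithCompactParameters {V : Type*} [Fintype V] (p : WeightedLanguage V) :
    Prop :=
  ∃ (M : ParametricModel V) (θ : ℕ → List Bool), M.EfficientlyComputes θ p

end SeqModel

end

/-!
By the chain rule, `p x = p(x₁ | ε) ⋯ p(xₙ | x₁ … xₙ₋₁) · p($ | x)`, so `p x` is computed by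
running the local normalizer `q` on `n + 1` queries and multiplying the fractions that it outputs.
For a fixed length `n` and a time bound `T` of `q` this is a straight-line program: write the query
on scratch tapes, simulate exactly `T` steps of `q`, and read its output from right to left, adding
a shifted copy of a product register for every bit (long multiplication). The registers hold the
numerators and denominators in binary, and their fixed width exceeds the total length of all
outputs, so that arithmetic modulo `2 ^ width` is exact. A straight-line program is a Turing machine
whose state records the position in the program, so the parameter for length `n` can be the
description of that machine, of polynomial length, and the parametric model only copies it. After a
prefix of weight `0` the behaviour of `q` is arbitrary, but the numerator is then `0` and stays `0`.
-/

noncomputable section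

namespace SeqModel

open Turing (Dir Tape ListBlank)

/-! ### Tapes as functions on the integers -/

/-- The displacement of the head that a movement causes. -/
def moveOffset : Option Dir → ℤ
  | none => 0
  | some Dir.left => -1
  | some Dir.right => 1

/-- The effect of a transition on a tape that is given by its contents relative to the head. -/
def writeMove {Γ : Type*} (f : ℤ → Γ) (a : Γ) (d : Option Dir) : ℤ → Γ :=
  fun i => Function.update f 0 a (i + moveOffset d)

/-- The tape `f` with its head moved to position `j`. -/
def shift {Γ : Type*} (j : ℤ) (f : ℤ → Γ) : ℤ → Γ :=
  fun i => f (i + j)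

/-- The tape `g` with its cells `0, …, n - 1` replaced by those of `f`. -/
def overwrite {Γ : Type*} (n : ℕ) (f : ℕ → Γ) (g : ℤ → Γ) : ℤ → Γ :=
  fun i => if 0 ≤ i ∧ i < n then f i.toNat else g i

/-- The tape that holds the word `w` from the head rightwards, and blanks elsewhere. -/
def wordTape {Γ : Type*} [Inhabited Γ] (w : List Γ) : ℤ → Γ :=
  overwrite w.length w.getI fun _ => default

/-- The tape `f` is blank at distance more than `R` from its head. -/
def BlankBeyond {Γ : Type*} [Inhabited Γ] (R : ℕ) (f : ℤ → Γ) : Prop :=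
  ∀ i : ℤ, R < |i| → f i = default

section Tapes

variable {Γ : Type*}

@[simp] lemma shift_zero (f : ℤ → Γ) : shift 0 f = f := by
  funext i; simp only [shift, add_zero]

@[simp] lemma shift_shift (a b : ℤ) (f : ℤ → Γ) : shift a (shift b f) = shift (a + b) f := by
  funext i; simp only [shift, add_assoc]

lemma shift_apply_zero (j : ℤ) (f : ℤ → Γ) : shift j f 0 = f j := by
  simp only [shift, zero_add]

lemma writeMove_head (f : ℤ → Γ) (d : Option Dir) :
    writeMove f (f 0) d = shift (moveOffset d) f := by
  funext i; simp only [writeMove, Function.update_eq_self, shift]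

lemma writeMove_shift (j : ℤ) (f : ℤ → Γ) (a : Γ) (d : Option Dir) :
    writeMove (shift j f) a d = shift (moveOffset d + j) (Function.update f j a) := by
  funext i
  have h : i + moveOffset d = 0 ↔ i + (moveOffset d + j) = j := by omega
  simp only [writeMove, shift, Function.update_apply, h, add_assoc]

@[simp] lemma overwrite_zero (f : ℕ → Γ) (g : ℤ → Γ) : overwrite 0 f g = g := by
  funext i; simp only [overwrite]; exact if_neg (by omega)

lemma overwrite_succ (n : ℕ) (f : ℕ → Γ) (g : ℤ → Γ) :
    overwrite (n + 1) f g = Function.update (overwrite n f g) n (f n) := by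
  funext i
  simp only [overwrite, Function.update_apply]
  grind

lemma overwrite_natCast_of_lt {n j : ℕ} (h : j < n) (f : ℕ → Γ) (g : ℤ → Γ) :
    overwrite n f g j = f j := by
  simp only [overwrite, Int.toNat_natCast]; exact if_pos (by omega)

lemma overwrite_natCast_of_le {n j : ℕ} (h : n ≤ j) (f : ℕ → Γ) (g : ℤ → Γ) :
    overwrite n f g j = g j := by
  simp only [overwrite]; exact if_neg (by omega)

variable [Inhabited Γ]

@[simp] lemma wordTape_nil : wordTape ([] : List Γ) = fun _ => default :=
  overwrite_zero _ _

lemma wordTape_natCast (w : List Γ) (i : ℕ) : wordTape w i = w.getI i := by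
  rcases lt_or_ge i w.length with h | h
  · exact overwrite_natCast_of_lt h _ _
  · rw [wordTape, overwrite_natCast_of_le h, List.getI_eq_default _ h]

lemma wordTape_of_neg (w : List Γ) {i : ℤ} (h : i < 0) : wordTape w i = default :=
  if_neg (by omega)

lemma blankBeyond_wordTape {w : List Γ} {R : ℕ} (h : w.length ≤ R) :
    BlankBeyond R (wordTape w) :=
  fun _ hi => if_neg (by rw [lt_abs] at hi; omega)

lemma BlankBeyond.mono {R R' : ℕ} {f : ℤ → Γ} (h : BlankBeyond R f) (hR : R ≤ R') :
    BlankBeyond R' f :=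
  fun i hi => h i (by omega)

lemma BlankBeyond.shift_neg_one {R : ℕ} {f : ℤ → Γ} (h : BlankBeyond R f) :
    BlankBeyond (R + 1) (shift (-1) f) :=
  fun i hi => h _ (by rw [lt_abs] at hi ⊢; omega)

lemma BlankBeyond.writeMove {R : ℕ} {f : ℤ → Γ} (h : BlankBeyond R f) (a : Γ) (d : Option Dir) :
    BlankBeyond (R + 1) (writeMove f a d) := by
  intro i hi
  have hd : |moveOffset d| ≤ 1 := by rcases d with _ | _ | _ <;> decide
  rw [lt_abs] at hi
  rw [abs_le] at hd
  push_cast at hi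
  have hR : (R : ℤ) < |i + moveOffset d| := by rw [lt_abs]; omega
  rw [SeqModel.writeMove, Function.update_of_ne (by omega), h _ hR]

lemma BlankBeyond.length_le {R : ℕ} {f : ℤ → Γ} (h : BlankBeyond R f) {w : List Γ}
    (hw : ∀ a ∈ w, a ≠ default) (hf : ∀ i : ℕ, f i = w.getI i) : w.length ≤ R + 1 := by
  by_contra! hlt
  refine hw _ (List.getElem_mem hlt) ?_
  rw [← List.getI_eq_getElem, ← hf, h]
  rw [abs_of_nonneg (by positivity)]
  push_cast
  omega

lemma act_nth (T : Tape Γ) (a : Γ) (d : Option Dir) :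
    (TM.act T a d).nth = writeMove T.nth a d := by
  have hw : (T.write a).nth = Function.update T.nth 0 a := by
    funext i; rw [Tape.write_nth, Function.update_apply]
  funext i
  rcases d with _ | _ | _
  · simp only [TM.act, writeMove, moveOffset, hw, add_zero]
  · simp only [TM.act, writeMove, moveOffset, Tape.move_left_nth, hw, sub_eq_add_neg]
  · simp only [TM.act, writeMove, moveOffset, Tape.move_right_nth, hw]

lemma mk₁_nth (w : List Γ) : (Tape.mk₁ w).nth = wordTape w := by
  funext i
  rcases i with i | i
  · rw [Int.ofNat_eq_natCast, wordTape_natCast]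
    simp [Tape.mk₁, Tape.mk₂]
  · rw [wordTape_of_neg w (Int.negSucc_lt_zero i)]
    simp [Tape.mk₁, Tape.mk₂, Tape.mk', Tape.nth]

lemma right₀_eq_mk_iff (T : Tape Γ) (w : List Γ) :
    T.right₀ = ListBlank.mk w ↔ ∀ i : ℕ, T.nth i = w.getI i := by
  simp only [← ListBlank.nth_mk, ← Tape.right₀_nth]
  exact ⟨fun h i => by rw [h], ListBlank.ext⟩

end Tapes

/-! ### Instructions and runs -/

/-- The control data and the contents of the tapes relative to their heads. -/
abbrev Store (σ ι Γ : Type*) := σ × (ι → ℤ → Γ)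

/-- An instruction determines, from the control data and the scanned symbols, the new control data
and, for each tape, the symbol to write and the head movement. -/
abbrev Instr (σ ι Γ : Type*) := σ → (ι → Γ) → σ × (ι → Γ × Option Dir)

/-- The effect of an instruction on a store. -/
def Instr.exec {σ ι Γ : Type*} (a : Instr σ ι Γ) (s : Store σ ι Γ) : Store σ ι Γ :=
  let r := a s.1 fun i => s.2 i 0
  (r.1, fun i => writeMove (s.2 i) (r.2 i).1 (r.2 i).2)

/-- The tapes at the beginning of a run: the input is on the tape `i₀`, the others are blank. -/
def inputTapes {ι Γ : Type*} [DecidableEq ι] [Inhabited Γ] (i₀ : ι) (w : List Γ) : ι → ℤ → Γ :=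
  fun i => wordTape (if i = i₀ then w else [])

/-- The store of a configuration of a Turing machine, with the state as control data. -/
def Cfg.store {k : ℕ} {Γ : Type*} [Inhabited Γ] (c : Cfg k Γ) : Store ℕ (Fin (k + 1)) Γ :=
  (c.state, fun i => (c.tape i).nth)

open Classical in
/-- The transition function of a Turing machine as an instruction. -/
def TM.toInstr {k : ℕ} {Γ : Type*} (M : TM k Γ) : Instr ℕ (Fin (k + 1)) Γ := fun n a =>
  if n = 1 then (n, fun i => (a i, none))
  else
    match M.rules.find? fun r => decide (r.src = n ∧ r.read = a) with
    | none => (n, fun i => (a i, none))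
    | some r => (r.tgt, fun i => (r.write i, r.move i))

lemma Instr.blankBeyond_exec_iterate {σ ι Γ : Type*} [Inhabited Γ] (a : Instr σ ι Γ)
    {s : Store σ ι Γ} {R : ℕ} (h : ∀ i, BlankBeyond R (s.2 i)) (t : ℕ) (i : ι) :
    BlankBeyond (R + t) ((a.exec^[t] s).2 i) := by
  induction t generalizing i with
  | zero => exact h i
  | succ t ih =>
    rw [Function.iterate_succ_apply']
    exact (ih i).writeMove _ _

lemma blankBeyond_inputTapes {ι Γ : Type*} [DecidableEq ι] [Inhabited Γ] (i₀ : ι) (w : List Γ)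
    (i : ι) : BlankBeyond w.length (inputTapes i₀ w i) := by
  refine blankBeyond_wordTape ?_
  split
  · exact le_rfl
  · exact Nat.zero_le _

namespace TM

variable {k : ℕ} {Γ : Type*}

lemma toInstr_fst_lt (M : TM k Γ) {m n : ℕ} (hM : ∀ r ∈ M.rules, r.tgt < m) (hn : n < m)
    (a : Fin (k + 1) → Γ) : (M.toInstr n a).1 < m := by
  unfold toInstr
  split
  · exact hn
  split
  · exact hn
  · exact hM _ (List.mem_of_find?_eq_some ‹_›)

variable [Inhabited Γ]

lemma store_step (M : TM k Γ) (c : Cfg k Γ) : (M.step c).store = M.toInstr.exec c.store := by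
  have hidle : c.store = (c.state, fun i => writeMove (c.tape i).nth (c.tape i).head none) :=
    Prod.ext rfl (funext fun i => ((writeMove_head _ none).trans (shift_zero _)).symm)
  have hexec : M.toInstr.exec c.store =
      let r := M.toInstr c.state fun i => (c.tape i).head
      (r.1, fun i => writeMove (c.tape i).nth (r.2 i).1 (r.2 i).2) := rfl
  rw [hexec, step, toInstr]
  split
  · exact hidle
  split
  · exact hidle
  · simp only [Cfg.store, act_nth]

lemma store_run (M : TM k Γ) (w : List Γ) (t : ℕ) :
    (M.run w t).store = M.toInstr.exec^[t] (0, inputTapes 0 w) := by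
  have hinit : (init k w).store = (0, inputTapes 0 w) := by
    refine Prod.ext rfl (funext fun i => ?_)
    simp only [Cfg.store, init, inputTapes, ← mk₁_nth]
    split <;> rfl
  rw [run, ← hinit]
  exact Function.Semiconj.iterate_right (f := Cfg.store) M.store_step t _

lemma haltsWithin_iff (M : TM k Γ) (w : List Γ) (t : ℕ) :
    M.HaltsWithin w t ↔ (M.toInstr.exec^[t] (0, inputTapes 0 w)).1 = 1 := by
  rw [← store_run]; rfl

lemma outputsWithin_iff (M : TM k Γ) (w u : List Γ) (t : ℕ) :
    M.OutputsWithin w u t ↔ M.HaltsWithin w t ∧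
      ∀ i : ℕ, (M.toInstr.exec^[t] (0, inputTapes 0 w)).2 0 i = u.getI i := by
  rw [OutputsWithin, right₀_eq_mk_iff, ← store_run]; rfl

lemma run_add_of_halts {M : TM k Γ} {w : List Γ} {t : ℕ} (h : M.HaltsWithin w t) (d : ℕ) :
    M.run w (d + t) = M.run w t := by
  rw [run, Function.iterate_add_apply]
  exact Function.iterate_fixed (f := M.step) (if_pos h) d

lemma HaltsWithin.mono {M : TM k Γ} {w : List Γ} {t t' : ℕ} (h : M.HaltsWithin w t)
    (ht : t ≤ t') : M.HaltsWithin w t' := by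
  obtain ⟨d, rfl⟩ := Nat.exists_eq_add_of_le' ht
  rwa [HaltsWithin, run_add_of_halts h]

lemma Outputs.outputsWithin {M : TM k Γ} {w u : List Γ} {t : ℕ} (h : M.Outputs w u)
    (ht : M.HaltsWithin w t) : M.OutputsWithin w u t := by
  obtain ⟨t', h⟩ := h
  have hrun : M.run w t' = M.run w t := by
    rw [← run_add_of_halts h.1 t, ← run_add_of_halts ht t', add_comm]
  exact ⟨ht, hrun ▸ h.2⟩

lemma OutputsWithin.length_le {M : TM k Γ} {w u : List Γ} {t : ℕ} (h : M.OutputsWithin w u t)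
    (hu : ∀ a ∈ u, a ≠ default) : u.length ≤ w.length + t + 1 :=
  (M.toInstr.blankBeyond_exec_iterate (s := (0, inputTapes 0 w))
    (blankBeyond_inputTapes 0 w) t 0).length_le hu ((outputsWithin_iff ..).1 h).2

end TM

/-! ### Straight-line programs -/

section Programs

variable {σ ι Γ : Type*}

/-- The effect of a straight-line program, that is, of a list of instructions. -/
def execAll (p : List (Instr σ ι Γ)) (s : Store σ ι Γ) : Store σ ι Γ :=
  p.foldl (fun s a => a.exec s) s

@[simp] lemma execAll_nil (s : Store σ ι Γ) : execAll [] s = s := rfl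

@[simp] lemma execAll_cons (a : Instr σ ι Γ) (p : List (Instr σ ι Γ)) (s : Store σ ι Γ) :
    execAll (a :: p) s = execAll p (a.exec s) := rfl

@[simp] lemma execAll_append (p p' : List (Instr σ ι Γ)) (s : Store σ ι Γ) :
    execAll (p ++ p') s = execAll p' (execAll p s) :=
  List.foldl_append

lemma execAll_replicate (n : ℕ) (a : Instr σ ι Γ) (s : Store σ ι Γ) :
    execAll (List.replicate n a) s = a.exec^[n] s := by
  induction n generalizing s with
  | zero => rfl
  | succ n ih => rw [List.replicate_succ, execAll_cons, ih, Function.iterate_succ_apply]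

/-- The instruction that only changes the control data. -/
def setCtl (f : σ → σ) : Instr σ ι Γ :=
  fun c a => (f c, fun i => (a i, none))

open scoped Classical in
/-- The instruction that moves the heads of the tapes in `S`. -/
def moveHeads (S : Set ι) (d : Dir) : Instr σ ι Γ :=
  fun c a => (c, fun i => (a i, if i ∈ S then some d else none))

open scoped Classical in
/-- The instruction that applies the transducer step `a`, writes its results on the tapes in `S`,
and moves the heads of these tapes to the right. -/
def sweep (S : Set ι) (a : σ → (ι → Γ) → σ × (ι → Γ)) : Instr σ ι Γ :=
  fun c r => ((a c r).1, fun i => if i ∈ S then ((a c r).2 i, some Dir.right) else (r i, none))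

/-- The program that processes `n` cells of the tapes in `S` from left to right, applying `a j` to
the `j`-th cells, and returns the heads. -/
def pass (S : Set ι) (n : ℕ) (a : ℕ → σ → (ι → Γ) → σ × (ι → Γ)) : List (Instr σ ι Γ) :=
  (List.range n).map (fun j => sweep S (a j)) ++ List.replicate n (moveHeads S Dir.left)

open scoped Classical in
/-- The symbols scanned by a pass over the tapes in `S` at its `j`-th cells. -/
def scanned (S : Set ι) (τ : ι → ℤ → Γ) (j : ℕ) : ι → Γ :=
  fun i => τ i (if i ∈ S then j else 0)

/-- The control data of a pass over the tapes in `S` when it arrives at the `j`-th cells. -/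
def passCtl (S : Set ι) (a : ℕ → σ → (ι → Γ) → σ × (ι → Γ)) (s : Store σ ι Γ) : ℕ → σ
  | 0 => s.1
  | j + 1 => (a j (passCtl S a s j) (scanned S s.2 j)).1

lemma passCtl_invariant {β : Type*} {S : Set ι} {a : ℕ → σ → (ι → Γ) → σ × (ι → Γ)}
    {s : Store σ ι Γ} {f : σ → β} (h : ∀ j c r, f (a j c r).1 = f c) (j : ℕ) :
    f (passCtl S a s j) = f s.1 := by
  induction j with
  | zero => rfl
  | succ j ih => rw [passCtl, h, ih]

@[simp] lemma setCtl_exec (f : σ → σ) (s : Store σ ι Γ) : (setCtl f).exec s = (f s.1, s.2) := by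
  simp [setCtl, Instr.exec, writeMove_head, moveOffset]

open scoped Classical in
lemma moveHeads_exec_iterate (S : Set ι) (d : Dir) (n : ℕ) (s : Store σ ι Γ) :
    (moveHeads S d).exec^[n] s =
      (s.1, S.piecewise (fun i => shift (n * moveOffset (some d)) (s.2 i)) s.2) := by
  induction n with
  | zero =>
    refine Prod.ext rfl (funext fun i => ?_)
    by_cases h : i ∈ S <;> simp [h]
  | succ n ih =>
    rw [Function.iterate_succ_apply', ih]
    refine Prod.ext rfl (funext fun i => ?_)
    by_cases h : i ∈ S
    · simp [Instr.exec, moveHeads, h, writeMove_head, add_mul, add_comm]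
    · simp [Instr.exec, moveHeads, h, writeMove_head, moveOffset]

open scoped Classical in
lemma execAll_sweeps (S : Set ι) (a : ℕ → σ → (ι → Γ) → σ × (ι → Γ)) (n : ℕ)
    (s : Store σ ι Γ) :
    execAll ((List.range n).map fun j => sweep S (a j)) s =
      (passCtl S a s n, S.piecewise (fun i => shift n (overwrite n
        (fun j => (a j (passCtl S a s j) (scanned S s.2 j)).2 i) (s.2 i))) s.2) := by
  induction n with
  | zero =>
    refine Prod.ext rfl (funext fun i => ?_)
    by_cases h : i ∈ S <;> simp [h]
  | succ n ih =>
    rw [List.range_succ, List.map_append, execAll_append, ih, List.map_singleton, execAll_cons,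
      execAll_nil, Instr.exec]
    have hread : (fun i => S.piecewise (fun i => shift n (overwrite n
        (fun j => (a j (passCtl S a s j) (scanned S s.2 j)).2 i) (s.2 i))) s.2 i 0) =
        scanned S s.2 n := by
      funext i
      by_cases h : i ∈ S
      · simp [h, scanned, shift_apply_zero, overwrite_natCast_of_le]
      · simp [h, scanned]
    simp only [hread]
    refine Prod.ext rfl (funext fun i => ?_)
    by_cases h : i ∈ S
    · simp [sweep, h, writeMove_shift, overwrite_succ, moveOffset, add_comm]
    · have h0 : scanned S s.2 n i = s.2 i 0 := by simp [scanned, h]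
      simp [sweep, h, h0, writeMove_head, moveOffset]

open scoped Classical in
lemma execAll_pass (S : Set ι) (n : ℕ) (a : ℕ → σ → (ι → Γ) → σ × (ι → Γ)) (s : Store σ ι Γ) :
    execAll (pass S n a) s =
      (passCtl S a s n, S.piecewise (fun i => overwrite n
        (fun j => (a j (passCtl S a s j) (scanned S s.2 j)).2 i) (s.2 i)) s.2) := by
  rw [pass, execAll_append, execAll_sweeps, execAll_replicate, moveHeads_exec_iterate]
  refine Prod.ext rfl (funext fun i => ?_)
  by_cases h : i ∈ S <;> simp [h, moveOffset]

@[simp] lemma length_pass (S : Set ι) (n : ℕ) (a : ℕ → σ → (ι → Γ) → σ × (ι → Γ)) :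
    (pass S n a).length = n + n := by
  simp [pass]

end Programs

/-! ### Compilation -/

/-- The Turing machine whose states are the numbers `ν x` of the elements `x` of a finite type,
and whose transition function is `δ`. -/
def TM.ofTable {α Γ : Type*} {k : ℕ} [Fintype α] [Fintype Γ] (ν : α → ℕ)
    (δ : α → (Fin (k + 1) → Γ) → ℕ × (Fin (k + 1) → Γ × Option Dir)) : TM k Γ :=
  ⟨(Finset.univ : Finset (α × (Fin (k + 1) → Γ))).toList.map fun x =>
    { src := ν x.1
      read := x.2
      tgt := (δ x.1 x.2).1
      write := fun i => ((δ x.1 x.2).2 i).1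
      move := fun i => ((δ x.1 x.2).2 i).2 }⟩

lemma TM.toInstr_ofTable {α Γ : Type*} {k : ℕ} [Fintype α] [Fintype Γ] {ν : α → ℕ}
    (hν : Function.Injective ν) (δ : α → (Fin (k + 1) → Γ) → ℕ × (Fin (k + 1) → Γ × Option Dir))
    {x : α} (hx : ν x ≠ 1) (a : Fin (k + 1) → Γ) :
    (TM.ofTable ν δ).toInstr (ν x) a = δ x a := by
  rw [TM.toInstr, if_neg hx]
  split
  · rename_i hnone
    simp only [TM.ofTable, List.find?_eq_none, List.mem_map, Finset.mem_toList, Finset.mem_univ,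
      true_and, decide_eq_true_eq] at hnone
    exact absurd ⟨rfl, rfl⟩ (hnone _ ⟨(x, a), rfl⟩)
  · rename_i r hsome
    obtain ⟨y, -, rfl⟩ := List.mem_map.1 (List.mem_of_find?_eq_some hsome)
    obtain ⟨hy, hread⟩ : ν y.1 = ν x ∧ y.2 = a := by simpa using List.find?_some hsome
    rw [← hν hy, ← hread]

section Compile

variable {σ ι Γ : Type*} [Fintype σ] {k : ℕ}

/-- The numbers of the machine states of a compiled program with `T` instructions: `none` is the
initial state, and `some (i, c)` means that instruction `i` has to be executed with the control
data `c`. -/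
def stateNum {T : ℕ} : Option (Fin T × σ) → ℕ
  | none => 0
  | some x => 2 + Fintype.equivFin (Fin T × σ) x

/-- The number of the machine state in which instruction `i` of a program with `T` instructions has
to be executed, or of the halting state if there is no such instruction. -/
def nextStateNum (T i : ℕ) (c : σ) : ℕ :=
  if h : i < T then stateNum (some (⟨i, h⟩, c)) else 1

/-- The transition function of the Turing machine that runs the straight-line program `p` from the
control data `c₀`. -/
def compileStep (e : ι ≃ Fin (k + 1)) (p : List (Instr σ ι Γ)) (c₀ : σ) :
    Option (Fin p.length × σ) → (Fin (k + 1) → Γ) → ℕ × (Fin (k + 1) → Γ × Option Dir)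
  | none, a => (nextStateNum p.length 0 c₀, fun j => (a j, none))
  | some (i, c), a =>
    let r := p[i] c fun t => a (e t)
    (nextStateNum p.length (i + 1) r.1, fun j => r.2 (e.symm j))

/-- The Turing machine that runs the straight-line program `p` from the control data `c₀`. -/
def compile [Fintype Γ] (e : ι ≃ Fin (k + 1)) (p : List (Instr σ ι Γ)) (c₀ : σ) : TM k Γ :=
  TM.ofTable stateNum (compileStep e p c₀)

lemma stateNum_injective (T : ℕ) :
    Function.Injective (stateNum : Option (Fin T × σ) → ℕ) := by
  rintro (_ | x) (_ | y) h
  · rfl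
  · simp only [stateNum] at h; omega
  · simp only [stateNum] at h; omega
  · simpa [stateNum, Fin.val_inj] using h

lemma stateNum_ne_one {T : ℕ} (x : Option (Fin T × σ)) : stateNum x ≠ 1 := by
  rcases x with _ | x <;> simp only [stateNum] <;> omega

lemma stateNum_le {T : ℕ} (x : Option (Fin T × σ)) : stateNum x ≤ 2 + T * Fintype.card σ := by
  rcases x with _ | x
  · exact Nat.zero_le _
  · have hcard : Fintype.card (Fin T × σ) = T * Fintype.card σ := by simp
    have := (Fintype.equivFin (Fin T × σ) x).is_lt
    simp only [stateNum]
    omega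

lemma nextStateNum_le (T i : ℕ) (c : σ) : nextStateNum T i c ≤ 2 + T * Fintype.card σ := by
  unfold nextStateNum
  split
  · exact stateNum_le _
  · omega

variable [Fintype Γ] [Inhabited Γ] [DecidableEq ι]

lemma compile_exec_iterate (e : ι ≃ Fin (k + 1)) {i₀ : ι} (h₀ : e i₀ = 0)
    (p : List (Instr σ ι Γ)) (c₀ : σ) (w : List Γ) {t : ℕ} (ht : t ≤ p.length) :
    (compile e p c₀).toInstr.exec^[t + 1] (0, inputTapes 0 w) =
      let s := execAll (p.take t) (c₀, inputTapes i₀ w)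
      (nextStateNum p.length t s.1, fun j => s.2 (e.symm j)) := by
  have htable (x : Option (Fin p.length × σ)) (a : Fin (k + 1) → Γ) :
      (compile e p c₀).toInstr (stateNum x) a = compileStep e p c₀ x a :=
    TM.toInstr_ofTable (stateNum_injective _) _ (stateNum_ne_one x) a
  induction t with
  | zero =>
    have hstart (a : Fin (k + 1) → Γ) :
        (compile e p c₀).toInstr 0 a = (nextStateNum p.length 0 c₀, fun j => (a j, none)) :=
      htable none a
    rw [zero_add, Function.iterate_one, Instr.exec, hstart]
    refine Prod.ext rfl (funext fun j => ?_)
    simp [writeMove_head, inputTapes, moveOffset, Equiv.symm_apply_eq, h₀]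
  | succ t ih =>
    have hlt : t < p.length := ht
    rw [Function.iterate_succ_apply', ih hlt.le, ← List.take_append_getElem hlt, execAll_append]
    simp only [nextStateNum, dif_pos hlt]
    rw [Instr.exec, htable]
    simp [compileStep, nextStateNum, Instr.exec]

lemma compile_outputsWithin (e : ι ≃ Fin (k + 1)) {i₀ : ι} (h₀ : e i₀ = 0)
    (p : List (Instr σ ι Γ)) (c₀ : σ) {w u : List Γ}
    (h : ∀ j : ℕ, (execAll p (c₀, inputTapes i₀ w)).2 i₀ j = u.getI j) :
    (compile e p c₀).OutputsWithin w u (p.length + 1) := by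
  rw [TM.outputsWithin_iff, TM.haltsWithin_iff, compile_exec_iterate e h₀ p c₀ w le_rfl,
    List.take_length, ← h₀]
  simpa [nextStateNum] using h

end Compile

lemma exists_equiv_fin_apply_eq_zero {ι : Type*} [Finite ι] (i₀ : ι) :
    ∃ (k : ℕ) (e : ι ≃ Fin (k + 1)), e i₀ = 0 := by
  obtain ⟨n, ⟨e⟩⟩ := Finite.exists_equiv_fin ι
  obtain ⟨k, rfl⟩ : ∃ k, n = k + 1 := Nat.exists_eq_succ_of_ne_zero (e i₀).pos.ne'
  exact ⟨k, e.trans (Equiv.swap (e i₀) 0), by simp⟩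

section Scan

variable {σ ι Γ : Type*}

lemma shift_overwrite_shift (B : ℕ) (h : ℕ → Γ) (f : ℤ → Γ) (i : ℤ) :
    shift B (overwrite (2 * B + 1) h (shift (-B) f)) i =
      if |i| ≤ B then h (i + B).toNat else f i := by
  simp only [shift, overwrite, abs_le]
  split_ifs <;> first | rfl | omega | simp

/-- The program that applies `a j` to the cells `j` of the tapes in `S`, for `j = -B, …, B` one
after the other, and returns the heads. -/
def scan (S : Set ι) (B : ℕ) (a : ℤ → σ → (ι → Γ) → σ × (ι → Γ)) : List (Instr σ ι Γ) :=
  List.replicate B (moveHeads S Dir.left) ++ pass S (2 * B + 1) (fun j => a (j - B)) ++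
    List.replicate B (moveHeads S Dir.right)

@[simp] lemma length_scan (S : Set ι) (B : ℕ) (a : ℤ → σ → (ι → Γ) → σ × (ι → Γ)) :
    (scan S B a).length = 6 * B + 2 := by
  simp only [scan, List.length_append, List.length_replicate, length_pass]
  omega

open scoped Classical in
lemma execAll_scan (S : Set ι) (B : ℕ) {a : ℤ → σ → (ι → Γ) → σ × (ι → Γ)}
    (ha : ∀ j c r, (a j c r).1 = c) (s : Store σ ι Γ) :
    execAll (scan S B a) s =
      (s.1, fun i => if i ∈ S then fun j : ℤ => if |j| ≤ B then
        (a j s.1 fun i' => s.2 i' (if i' ∈ S then j else 0)).2 i else s.2 i j else s.2 i) := by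
  have hctl (s : Store σ ι Γ) (j : ℕ) : passCtl S (fun j : ℕ => a (j - B)) s j = s.1 :=
    passCtl_invariant (f := id) (fun j c r => ha _ c r) j
  rw [scan, execAll_append, execAll_append, execAll_replicate, moveHeads_exec_iterate,
    execAll_pass, execAll_replicate, moveHeads_exec_iterate]
  simp only [hctl]
  refine Prod.ext rfl (funext fun i => ?_)
  by_cases hi : i ∈ S
  · simp only [Set.piecewise_eq_of_mem _ _ _ hi, hi, if_true, moveOffset, mul_one, mul_neg]
    funext j
    rw [shift_overwrite_shift]
    refine if_ctx_congr Iff.rfl (fun hj => ?_) fun _ => rfl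
    have hj' : ((j + B).toNat : ℤ) - B = j := by rw [abs_le] at hj; omega
    rw [hj']
    refine congrArg (fun r => (a j s.1 r).2 i) (funext fun i' => ?_)
    by_cases hi' : i' ∈ S
    · simpa [scanned, hi', shift, ← sub_eq_add_neg] using congrArg (s.2 i') hj'
    · simp [scanned, hi']
  · simp [hi]

end Scan

/-! ### Lengths of descriptions -/

section Encode

variable {V : Type*} [Fintype V] {g k : ℕ}

lemma Sym.code_lt (s : Sym V g) : s.code < 5 + Fintype.card V + g := by
  rcases s with _ | (_ | _) | _ | _ | v | i <;> simp only [Sym.code] <;> omega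

lemma Sym.code_injective : Function.Injective (Sym.code : Sym V g → ℕ) := by
  intro s s' h
  rcases s with _ | (_ | _) | _ | _ | v | i <;> rcases s' with _ | (_ | _) | _ | _ | v' | i' <;>
    simp only [Sym.code] at h <;> first | rfl | omega | skip
  · exact congrArg _ ((Fintype.equivFin V).injective (Fin.ext (by omega)))
  · exact congrArg _ (Fin.ext (by omega))

instance : Fintype (Sym V g) :=
  have : Finite (Sym V g) :=
    Finite.of_injective (fun s : Sym V g => (⟨s.code, s.code_lt⟩ : Fin _))
      fun _ _ h => Sym.code_injective (Fin.mk.inj h)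
  Fintype.ofFinite _

lemma encNat_length (n : ℕ) : (encNat n).length = n + 1 := by
  simp [encNat]

lemma encMove_length_le (d : Option Dir) : (encMove d).length ≤ 3 := by
  rcases d with _ | _ | _ <;> simp [encMove, encNat]

lemma length_flatten_ofFn_le {α : Type*} {n B : ℕ} (f : Fin n → List α)
    (h : ∀ i, (f i).length ≤ B) : (List.ofFn f).flatten.length ≤ n * B := by
  rw [List.length_flatten, List.map_ofFn, List.sum_ofFn]
  simpa using Finset.sum_le_sum fun i (_ : i ∈ Finset.univ) => h i

lemma Rule.encode_length_le (r : Rule k (Sym V g)) :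
    r.encode.length ≤ r.src + r.tgt + (2 + 2 * ((k + 1) * (8 + Fintype.card V + g))) := by
  have hread := length_flatten_ofFn_le (B := 8 + Fintype.card V + g)
    (fun i => encNat (r.read i).code) fun i => by
      have := (r.read i).code_lt
      rw [encNat_length]; omega
  have hwrite := length_flatten_ofFn_le (B := 8 + Fintype.card V + g)
    (fun i => encNat (r.write i).code ++ encMove (r.move i)) fun i => by
      have := (r.write i).code_lt
      have := encMove_length_le (r.move i)
      rw [List.length_append, encNat_length]; omega
  simp only [Rule.encode, List.length_append, encNat_length]
  omega

lemma Rule.tgt_lt_encode_length (r : Rule k (Sym V g)) : r.tgt < r.encode.length := by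
  simp only [Rule.encode, List.length_append, encNat_length]
  omega

lemma TM.tgt_lt_encode_length {M : TM k (Sym V g)} {r : Rule k (Sym V g)} (hr : r ∈ M.rules) :
    r.tgt < M.encode.length := by
  refine r.tgt_lt_encode_length.trans_le ?_
  rw [TM.encode, List.length_flatMap]
  exact List.single_le_sum (by simp) _ (List.mem_map.2 ⟨r, hr, rfl⟩)

lemma TM.encode_length_le {M : TM k (Sym V g)} {B : ℕ}
    (h : ∀ r ∈ M.rules, r.src ≤ B ∧ r.tgt ≤ B) :
    M.encode.length ≤
      M.rules.length * (2 * B + (2 + 2 * ((k + 1) * (8 + Fintype.card V + g)))) := by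
  rw [TM.encode, List.length_flatMap]
  refine (List.sum_le_card_nsmul _ (2 * B + (2 + 2 * ((k + 1) * (8 + Fintype.card V + g))))
    ?_).trans (by simp)
  simp only [List.forall_mem_map]
  intro r hr
  have := h r hr
  exact r.encode_length_le.trans (by omega)

lemma compile_encode_length_le {σ ι : Type*} [Fintype σ] (e : ι ≃ Fin (k + 1))
    (p : List (Instr σ ι (Sym V g))) (c₀ : σ) :
    (compile e p c₀).encode.length ≤
      (p.length * Fintype.card σ + 1) * Fintype.card (Sym V g) ^ (k + 1) *
        (2 * (2 + p.length * Fintype.card σ) +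
          (2 + 2 * ((k + 1) * (8 + Fintype.card V + g)))) := by
  have hlen : (compile e p c₀).rules.length =
      (p.length * Fintype.card σ + 1) * Fintype.card (Sym V g) ^ (k + 1) := by
    simp [compile, TM.ofTable]
  rw [← hlen]
  refine TM.encode_length_le fun r hr => ?_
  obtain ⟨⟨x, a⟩, -, rfl⟩ := List.mem_map.1 hr
  refine ⟨stateNum_le x, ?_⟩
  rcases x with _ | x <;> exact nextStateNum_le _ _ _

end Encode

/-! ### Binary numerals on tapes -/

lemma binVal_cons (b : Bool) (w : List Bool) : binVal (b :: w) = b.toNat + 2 * binVal w := by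
  simp [binVal, Nat.ofDigits_cons]

lemma binVal_append_singleton (w : List Bool) (b : Bool) :
    binVal (w ++ [b]) = binVal w + 2 ^ w.length * b.toNat := by
  simp [binVal, Nat.ofDigits_append]

lemma binVal_lt (w : List Bool) : binVal w < 2 ^ w.length := by
  simpa [binVal] using Nat.ofDigits_lt_base_pow_length one_lt_two (l := w.map Bool.toNat)
    (by simp only [List.forall_mem_map]; exact fun b _ => b.toNat_lt)

lemma binVal_eq_zero_iff (w : List Bool) : binVal w = 0 ↔ w.any id = false := by
  induction w with
  | nil => simp [binVal]
  | cons b w ih => simp [binVal_cons, ih]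

section TapeVal

variable {V : Type*} {g : ℕ}

/-- The binary digit that a tape symbol stands for; blanks count as the digit `0`. -/
def Sym.isOne : Sym V g → Bool
  | bit b => b
  | _ => false

/-- The digits of the numeral in the cells `0, …, W - 1` of a tape. -/
def tapeDigits (W : ℕ) (f : ℤ → Sym V g) : List Bool :=
  (List.range W).map fun j : ℕ => (f j).isOne

/-- The number written in binary in the cells `0, …, W - 1` of a tape. -/
def tapeVal (W : ℕ) (f : ℤ → Sym V g) : ℕ :=
  binVal (tapeDigits W f)

@[simp] lemma length_tapeDigits (W : ℕ) (f : ℤ → Sym V g) : (tapeDigits W f).length = W := by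
  simp [tapeDigits]

lemma tapeVal_lt (W : ℕ) (f : ℤ → Sym V g) : tapeVal W f < 2 ^ W :=
  (binVal_lt _).trans_eq (by rw [length_tapeDigits])

lemma tapeVal_eq_sum (W : ℕ) (f : ℤ → Sym V g) :
    tapeVal W f = ∑ j ∈ Finset.range W, 2 ^ j * (f j).isOne.toNat := by
  induction W with
  | zero => simp [tapeVal, tapeDigits, binVal]
  | succ W ih =>
    rw [Finset.sum_range_succ, ← ih, tapeVal, tapeDigits, List.range_succ, List.map_append]
    simp [binVal_append_singleton, tapeVal, tapeDigits]

end TapeVal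

/-! ### Multiplying fractions that are read from right to left -/

/-- The data of the multiplication of a fraction `num / den` by a fraction `a / b` whose symbols
are read from right to left: `res` is the product, by Horner's rule, of the part of `b` read so far
with `den` or, when `pastBar` says that the fraction bar has been read, of the part of `a` read so
far with `num`. -/
@[ext] structure Registers (R : Type*) where
  pastBar : Bool
  num : R
  den : R
  res : R

namespace Registers

variable {V R : Type*} {g : ℕ}

/-- The number by which the numeral that is being read has to be multiplied. -/
def factor (r : Registers R) : R :=
  if r.pastBar then r.num else r.den

variable [CommSemiring R]

/-- Reading one more symbol; the end-of-string symbol completes the multiplication. -/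
def step : Sym V g → Registers R → Registers R
  | .bit b, r => { r with res := 2 * r.res + b.toNat * r.factor }
  | .slash, r => { pastBar := true, num := r.num, den := r.res, res := 0 }
  | .eos, r =>
    { pastBar := false, num := if r.pastBar then r.res else r.num, den := r.den, res := 0 }
  | _, r => r

lemma foldr_step_bitWord {r : Registers R} (hr : r.res = 0) (a : List Bool) :
    (bitWord V g a).foldr step r = { r with res := binVal a * r.factor } := by
  induction a with
  | nil => rcases r with ⟨⟩; simp_all [bitWord, binVal]
  | cons b a ih =>
    simp only [bitWord, List.map_cons, List.foldr_cons] at ih ⊢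
    rw [ih, binVal_cons]
    simp only [step, factor, mk.injEq, true_and]
    push_cast
    ring

lemma foldr_step_blank (r : Registers R) (n : ℕ) :
    (List.replicate n (Sym.blank : Sym V g)).foldr step r = r := by
  induction n with
  | zero => rfl
  | succ n ih => rw [List.replicate_succ, List.foldr_cons, ih]; rfl

lemma foldr_step_fraction (x y : R) (a b : List Bool) (n : ℕ) :
    (Sym.eos :: ((bitWord V g a ++ Sym.slash :: bitWord V g b) ++
      List.replicate n Sym.blank)).foldr step ⟨false, x, y, 0⟩ =
      ⟨false, binVal a * x, binVal b * y, 0⟩ := by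
  simp only [List.foldr_cons, List.foldr_append, foldr_step_blank]
  rw [foldr_step_bitWord rfl]
  simp only [step]
  rw [foldr_step_bitWord rfl]
  simp [factor]

lemma num_foldr_step_eq_zero {r : Registers R} (hnum : r.num = 0) (hres : r.res = 0)
    (w : List (Sym V g)) :
    (w.foldr step r).num = 0 ∧ ((w.foldr step r).pastBar → (w.foldr step r).res = 0) := by
  induction w with
  | nil => exact ⟨hnum, fun _ => hres⟩
  | cons s w ih =>
    rw [List.foldr_cons]
    generalize w.foldr step r = r' at ih ⊢
    rcases s with _ | b | _ | _ | _ | _ <;> simp only [step]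
    · exact ih
    · exact ⟨ih.1, fun h => by simp [factor, ih.1, ih.2 h, h]⟩
    · exact ⟨ih.1, by simp⟩
    · exact ⟨by split <;> simp_all, by simp⟩
    · exact ih
    · exact ih

end Registers

lemma sum_digits_two_mul_add {x y c : ℕ → ℕ} (h₀ : c 0 = 0)
    (hc : ∀ j, c (j + 1) = (c j + y j) / 2 + x j) (n : ℕ) :
    ∑ j ∈ Finset.range n, 2 ^ j * ((c j + y j) % 2) + 2 ^ n * c n =
      2 * ∑ j ∈ Finset.range n, 2 ^ j * x j + ∑ j ∈ Finset.range n, 2 ^ j * y j := by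
  induction n with
  | zero => simp [h₀]
  | succ n ih =>
    simp only [Finset.sum_range_succ, hc]
    have hdiv := congrArg (2 ^ n * ·) (Nat.mod_add_div (c n + y n) 2)
    simp only [mul_add] at hdiv ih ⊢
    rw [pow_succ]
    linarith

/-! ### The multiplication on tapes -/

/-- The tapes of the multiplying machine besides those of the simulated machine: the input and
output tape, and the registers. -/
inductive WorkTape where
  | input
  | num
  | den
  | res
  deriving DecidableEq

instance : Fintype WorkTape :=
  ⟨{.input, .num, .den, .res}, by rintro (_ | _ | _ | _) <;> decide⟩

/-- The control data of the multiplying machine besides the state of the simulated machine: the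
symbol that is being read, whether the fraction bar has been read, the carry of an addition, and
whether a nonzero digit has been found. -/
structure Ctl (V : Type*) (g : ℕ) where
  sym : Sym V g
  pastBar : Bool
  carry : Fin 3
  nonzero : Bool

instance {V : Type*} [Fintype V] {g : ℕ} : Fintype (Ctl V g) :=
  have : Finite (Ctl V g) :=
    Finite.of_injective (fun c : Ctl V g => (c.sym, c.pastBar, c.carry, c.nonzero)) <| by
      rintro ⟨⟩ ⟨⟩ h
      simpa using h
  Fintype.ofFinite _

section Absorb

variable {V : Type*} {g : ℕ}

/-- The tape that holds the number by which the numeral that is being read has to be multiplied. -/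
def Ctl.factorTape (c : Ctl V g) : WorkTape :=
  if c.pastBar then .num else .den

/-- The transducer step on one digit of each register when a symbol is read. The carry includes the
digit of `res` that doubling moves up by one place. -/
def digitStep (c : Ctl V g) (r : WorkTape → Sym V g) : Ctl V g × (WorkTape → Sym V g) :=
  match c.sym with
  | .bit b =>
    let sum := c.carry.val + (b && (r c.factorTape).isOne).toNat
    ({ c with carry := Fin.ofNat 3 (sum / 2 + (r .res).isOne.toNat) },
      Function.update r .res (.bit (sum % 2 = 1)))
  | .slash => (c, Function.update (Function.update r .den (r .res)) .res .blank)
  | .eos => (c, Function.update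
      (Function.update r .num (if c.pastBar then r .res else r .num)) .res .blank)
  | _ => (c, r)

/-- The update of the control data after a symbol has been read. -/
def Ctl.settle (c : Ctl V g) : Ctl V g :=
  match c.sym with
  | .slash => { c with pastBar := true }
  | .eos => { c with pastBar := false }
  | _ => c

/-- The program that reads the symbol in the control data, with registers of `W` digits. -/
def absorb (V : Type*) (g W : ℕ) : List (Instr (Ctl V g) WorkTape (Sym V g)) :=
  setCtl (fun c => { c with carry := 0 }) :: pass {.input}ᶜ W (fun _ => digitStep) ++
    [setCtl Ctl.settle]

/-- The registers that the work tapes hold in their cells `0, …, W - 1`. -/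
def registers (W : ℕ) (s : Store (Ctl V g) WorkTape (Sym V g)) : Registers (ZMod (2 ^ W)) where
  pastBar := s.1.pastBar
  num := tapeVal W (s.2 .num)
  den := tapeVal W (s.2 .den)
  res := tapeVal W (s.2 .res)

lemma registers_factor (W : ℕ) (s : Store (Ctl V g) WorkTape (Sym V g)) :
    (registers W s).factor = tapeVal W (s.2 s.1.factorTape) := by
  rw [registers, Registers.factor, Ctl.factorTape]
  split <;> rfl

lemma tapeVal_overwrite (W : ℕ) (f : ℕ → Sym V g) (h : ℤ → Sym V g) :
    tapeVal W (overwrite W f h) = ∑ j ∈ Finset.range W, 2 ^ j * (f j).isOne.toNat := by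
  rw [tapeVal_eq_sum]
  refine Finset.sum_congr rfl fun j hj => ?_
  rw [overwrite_natCast_of_lt (Finset.mem_range.1 hj)]

lemma isOne_bit_mod_two (n : ℕ) : (Sym.bit (n % 2 = 1) : Sym V g).isOne.toNat = n % 2 := by
  rcases Nat.mod_two_eq_zero_or_one n with h | h <;> simp [h, Sym.isOne]

lemma scanned_of_ne_input {s : Store (Ctl V g) WorkTape (Sym V g)} {t : WorkTape}
    (ht : t ≠ .input) (j : ℕ) : scanned {.input}ᶜ s.2 j t = s.2 t j := by
  simp [scanned, ht]

lemma digitStep_fst (c : Ctl V g) (r : WorkTape → Sym V g) :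
    ((digitStep c r).1.sym, (digitStep c r).1.pastBar) = (c.sym, c.pastBar) := by
  unfold digitStep
  split <;> rfl

lemma passCtl_digitStep (s : Store (Ctl V g) WorkTape (Sym V g)) (j : ℕ) :
    (passCtl {.input}ᶜ (fun _ => digitStep) s j).sym = s.1.sym ∧
      (passCtl {.input}ᶜ (fun _ => digitStep) s j).pastBar = s.1.pastBar :=
  Prod.mk_inj.1 (passCtl_invariant (f := fun c : Ctl V g => (c.sym, c.pastBar))
    (fun _ => digitStep_fst) j)

lemma tapeVal_pass_digitStep (W : ℕ) (s : Store (Ctl V g) WorkTape (Sym V g)) {t : WorkTape}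
    (ht : t ≠ .input) :
    tapeVal W ((execAll (pass {.input}ᶜ W fun _ => digitStep) s).2 t) =
      ∑ j ∈ Finset.range W, 2 ^ j * ((digitStep (passCtl {.input}ᶜ (fun _ => digitStep) s j)
        (scanned {.input}ᶜ s.2 j)).2 t).isOne.toNat := by
  rw [execAll_pass]
  simp only [Set.mem_compl_iff, Set.mem_singleton_iff, ht, not_false_eq_true,
    Set.piecewise_eq_of_mem, tapeVal_overwrite]

lemma digitStep_passCtl_bit {s : Store (Ctl V g) WorkTape (Sym V g)} {b : Bool}
    (hsym : s.1.sym = .bit b) (j : ℕ) :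
    let c := passCtl {.input}ᶜ (fun _ => digitStep) s j
    let sum := c.carry.val + (b && (s.2 s.1.factorTape j).isOne).toNat
    digitStep c (scanned {.input}ᶜ s.2 j) =
      ({ c with carry := Fin.ofNat 3 (sum / 2 + (s.2 .res j).isOne.toNat) },
        Function.update (scanned {.input}ᶜ s.2 j) .res (.bit (sum % 2 = 1))) := by
  have hfac : scanned {.input}ᶜ s.2 j s.1.factorTape = s.2 s.1.factorTape j :=
    scanned_of_ne_input (by unfold Ctl.factorTape; split <;> simp) j
  have hfac' : (passCtl {.input}ᶜ (fun _ => digitStep) s j).factorTape = s.1.factorTape := by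
    rw [Ctl.factorTape, (passCtl_digitStep s j).2, Ctl.factorTape]
  simp only [digitStep, passCtl_digitStep, hsym, hfac', hfac,
    scanned_of_ne_input (show WorkTape.res ≠ .input by simp)]

lemma tapeVal_res_pass_digitStep_bit {s : Store (Ctl V g) WorkTape (Sym V g)} {b : Bool}
    (hsym : s.1.sym = .bit b) (hcarry : s.1.carry = 0) (W : ℕ) :
    (tapeVal W ((execAll (pass {.input}ᶜ W fun _ => digitStep) s).2 .res) : ZMod (2 ^ W)) =
      2 * tapeVal W (s.2 .res) + b.toNat * (registers W s).factor := by
  set carry : ℕ → ℕ := fun j => (passCtl {.input}ᶜ (fun _ => digitStep) s j).carry with hcarry'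
  set x : ℕ → ℕ := fun j => (s.2 .res j).isOne.toNat
  set y : ℕ → ℕ := fun j => (b && (s.2 s.1.factorTape j).isOne).toNat with hy
  have hsucc (j : ℕ) : carry (j + 1) = (carry j + y j) / 2 + x j := by
    have hxj : x j ≤ 1 := Bool.toNat_le _
    have hyj : y j ≤ 1 := Bool.toNat_le _
    have hcj : carry j < 3 := Fin.is_lt _
    simp only [hcarry', passCtl, digitStep_passCtl_bit hsym]
    exact Nat.mod_eq_of_lt (show (carry j + y j) / 2 + x j < 3 by omega)
  have hsum := sum_digits_two_mul_add (by simp [hcarry', passCtl, hcarry]) hsucc W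
  have hy_sum : ∑ j ∈ Finset.range W, 2 ^ j * y j = b.toNat * tapeVal W (s.2 s.1.factorTape) := by
    cases b <;> simp [hy, tapeVal_eq_sum]
  have hres : tapeVal W ((execAll (pass {.input}ᶜ W fun _ => digitStep) s).2 .res) =
      ∑ j ∈ Finset.range W, 2 ^ j * ((carry j + y j) % 2) := by
    rw [tapeVal_pass_digitStep W s (by simp)]
    refine Finset.sum_congr rfl fun j _ => ?_
    simp only [digitStep_passCtl_bit hsym, Function.update_self]
    rw [isOne_bit_mod_two]
  have hmod := congrArg (Nat.cast : ℕ → ZMod (2 ^ W)) (hres ▸ hsum)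
  have htwo : (2 : ZMod (2 ^ W)) ^ W = 0 := by exact_mod_cast ZMod.natCast_self (2 ^ W)
  rw [hy_sum, ← tapeVal_eq_sum] at hmod
  rw [registers_factor]
  push_cast [htwo] at hmod
  simpa using hmod

lemma registers_pass_digitStep {s : Store (Ctl V g) WorkTape (Sym V g)} (hcarry : s.1.carry = 0)
    (W : ℕ) :
    registers W (execAll (pass {.input}ᶜ W fun _ => digitStep) s) =
      { (registers W s).step s.1.sym with pastBar := s.1.pastBar } := by
  have hbar : (execAll (pass {.input}ᶜ W fun _ => digitStep) s).1.pastBar = s.1.pastBar := by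
    rw [execAll_pass]
    exact (passCtl_digitStep s W).2
  have hnum := tapeVal_pass_digitStep W s (t := .num) (by simp)
  have hden := tapeVal_pass_digitStep W s (t := .den) (by simp)
  have hres := tapeVal_pass_digitStep W s (t := .res) (by simp)
  rcases h : s.1.sym with _ | b | _ | _ | _ | _
  case bit =>
    have hres := tapeVal_res_pass_digitStep_bit h hcarry W
    simp only [digitStep_passCtl_bit h, ne_eq, reduceCtorEq, not_false_eq_true,
      Function.update_of_ne, scanned_of_ne_input, ← tapeVal_eq_sum] at hnum hden
    rw [registers, hbar, hnum, hden, hres]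
    rfl
  all_goals
    simp only [digitStep, passCtl_digitStep, h, ne_eq, reduceCtorEq, not_false_eq_true,
      Function.update_of_ne, Function.update_self, scanned_of_ne_input, ← tapeVal_eq_sum]
      at hnum hden hres
    rw [registers, hbar, hnum, hden, hres]
  case slash | eos =>
    cases hbar : s.1.pastBar <;>
      simp [registers, Registers.step, hbar, tapeVal_eq_sum, Sym.isOne]
  all_goals rfl

lemma registers_absorb (W : ℕ) (s : Store (Ctl V g) WorkTape (Sym V g)) :
    registers W (execAll (absorb V g W) s) = (registers W s).step s.1.sym := by
  set s₁ := execAll (pass {.input}ᶜ W fun _ => digitStep) ({ s.1 with carry := 0 }, s.2) with hs₁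
  have habsorb : registers W (execAll (absorb V g W) s) =
      { registers W s₁ with pastBar := s₁.1.settle.pastBar } := by
    simp only [absorb, List.cons_append, execAll_cons, execAll_append, execAll_nil, setCtl_exec]
    rfl
  obtain ⟨hsym, hbar⟩ : s₁.1.sym = s.1.sym ∧ s₁.1.pastBar = s.1.pastBar := by
    rw [hs₁, execAll_pass]
    exact passCtl_digitStep _ W
  rw [habsorb, registers_pass_digitStep rfl W]
  rcases h : s.1.sym <;> simp [Ctl.settle, hsym, hbar, h, registers, Registers.step]
  rfl

lemma execAll_absorb_input (W : ℕ) (s : Store (Ctl V g) WorkTape (Sym V g)) :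
    (execAll (absorb V g W) s).2 .input = s.2 .input := by
  simp [absorb, execAll_pass]

end Absorb

/-! ### Two machines side by side -/

section Joint

variable {ρ σ κ ι Γ : Type*}

/-- The store that consists of a store with control data in `ρ` and tapes `κ` and a store with
control data in `σ` and tapes `ι`. -/
def joint (s : Store ρ κ Γ) (s' : Store σ ι Γ) : Store (ρ × σ) (ι ⊕ κ) Γ :=
  ((s.1, s'.1), Sum.elim s'.2 s.2)

/-- An instruction that acts on the first part of a joint store. -/
def Instr.onFst (a : Instr ρ κ Γ) : Instr (ρ × σ) (ι ⊕ κ) Γ := fun c r =>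
  let x := a c.1 (r ∘ Sum.inr)
  ((x.1, c.2), Sum.elim (fun i => (r (.inl i), none)) x.2)

/-- An instruction that acts on the second part of a joint store. -/
def Instr.onSnd (a : Instr σ ι Γ) : Instr (ρ × σ) (ι ⊕ κ) Γ := fun c r =>
  let x := a c.2 (r ∘ Sum.inl)
  ((c.1, x.1), Sum.elim x.2 fun i => (r (.inr i), none))

lemma onFst_exec (a : Instr ρ κ Γ) (s : Store ρ κ Γ) (s' : Store σ ι Γ) :
    a.onFst.exec (joint s s') = joint (a.exec s) s' := by
  refine Prod.ext rfl (funext ?_)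
  rintro (i | i)
  · simp [Instr.exec, Instr.onFst, joint, writeMove_head, moveOffset]
  · rfl

lemma onSnd_exec (a : Instr σ ι Γ) (s : Store ρ κ Γ) (s' : Store σ ι Γ) :
    a.onSnd.exec (joint s s') = joint s (a.exec s') := by
  refine Prod.ext rfl (funext ?_)
  rintro (i | i)
  · rfl
  · simp [Instr.exec, Instr.onSnd, joint, writeMove_head, moveOffset]

lemma execAll_map_onFst (p : List (Instr ρ κ Γ)) (s : Store ρ κ Γ) (s' : Store σ ι Γ) :
    execAll (p.map Instr.onFst) (joint s s') = joint (execAll p s) s' := by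
  induction p generalizing s with
  | nil => rfl
  | cons a p ih => rw [List.map_cons, execAll_cons, onFst_exec, ih, execAll_cons]

lemma execAll_map_onSnd (p : List (Instr σ ι Γ)) (s : Store ρ κ Γ) (s' : Store σ ι Γ) :
    execAll (p.map Instr.onSnd) (joint s s') = joint s (execAll p s') := by
  induction p generalizing s' with
  | nil => rfl
  | cons a p ih => rw [List.map_cons, execAll_cons, onSnd_exec, ih, execAll_cons]

end Joint

/-- The transition function of a Turing machine on its states less than `m`. -/
def TM.toFinInstr {k : ℕ} {Γ : Type*} (M : TM k Γ) (m : ℕ) [NeZero m] :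
    Instr (Fin m) (Fin (k + 1)) Γ := fun n a =>
  (Fin.ofNat m (M.toInstr n a).1, (M.toInstr n a).2)

lemma TM.toFinInstr_exec_iterate {k m : ℕ} [NeZero m] {Γ : Type*} {M : TM k Γ}
    (hM : ∀ r ∈ M.rules, r.tgt < m) (s : Store (Fin m) (Fin (k + 1)) Γ) (t : ℕ) :
    Prod.map Fin.val id ((M.toFinInstr m).exec^[t] s) =
      M.toInstr.exec^[t] (Prod.map Fin.val id s) := by
  refine Function.Semiconj.iterate_right (f := Prod.map Fin.val id) (fun s => ?_) t s
  exact Prod.ext (Nat.mod_eq_of_lt (M.toInstr_fst_lt hM s.1.is_lt _)) rfl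

/-! ### One round of the multiplying machine -/

section Round

variable {V : Type*} {g k : ℕ} {ρ : Type*}

/-- The instructions of the multiplying machine, with the states of the simulated machine in `ρ`
and its tapes numbered by `Fin (k + 1)`. -/
abbrev MulInstr (V : Type*) (g k : ℕ) (ρ : Type*) :=
  Instr (ρ × Ctl V g) (WorkTape ⊕ Fin (k + 1)) (Sym V g)

/-- The instruction that stores the symbol that is scanned on the output tape of the simulated
machine, and moves the head of this tape to the left. -/
def fetch : MulInstr V g k ρ := fun c r =>
  ((c.1, { c.2 with sym := r (.inr 0) }),
    fun i => (r i, if i = .inr 0 then some Dir.left else none))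

/-- The program that fetches one symbol and reads it. -/
def readSym (V : Type*) (g k : ℕ) (ρ : Type*) (W : ℕ) : List (MulInstr V g k ρ) :=
  fetch :: (absorb V g W).map Instr.onSnd

/-- The program that completes a multiplication. -/
def complete (V : Type*) (g W : ℕ) : List (Instr (Ctl V g) WorkTape (Sym V g)) :=
  setCtl (fun c => { c with sym := .eos }) :: absorb V g W

lemma fetch_exec (n : ρ) (τ : Fin (k + 1) → ℤ → Sym V g) (f : ℤ → Sym V g)
    (s : Store (Ctl V g) WorkTape (Sym V g)) :
    fetch.exec (joint (n, Function.update τ 0 f) s) =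
      joint (n, Function.update τ 0 (shift (-1) f)) ({ s.1 with sym := f 0 }, s.2) := by
  refine Prod.ext ?_ (funext ?_)
  · simp only [Instr.exec, fetch, joint, Sum.elim_inr, Function.update_self]
  · rintro (i | i)
    · simp only [Instr.exec, fetch, joint, Sum.elim_inl, reduceCtorEq, if_false, writeMove_head,
        moveOffset, shift_zero]
    · by_cases hi : i = 0
      · subst hi
        simp only [Instr.exec, fetch, joint, Sum.elim_inr, Function.update_self, if_true,
          writeMove_head, moveOffset]
      · simp only [Instr.exec, fetch, joint, Sum.elim_inr, Sum.inr.injEq, hi, if_false,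
          writeMove_head, moveOffset, shift_zero, Function.update_of_ne, ne_eq, not_false_eq_true]

lemma execAll_readSym_replicate (W : ℕ) (n : ρ) (τ : Fin (k + 1) → ℤ → Sym V g)
    (f : ℤ → Sym V g) (m : ℕ) (s : Store (Ctl V g) WorkTape (Sym V g)) :
    ∃ s' : Store (Ctl V g) WorkTape (Sym V g),
      execAll (List.replicate m (readSym V g k ρ W)).flatten
        (joint (n, Function.update τ 0 (shift (m - 1) f)) s) =
        joint (n, Function.update τ 0 (shift (-1) f)) s' ∧
      s'.2 .input = s.2 .input ∧
      registers W s' =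
        ((List.range m).map fun j : ℕ => f j).foldr Registers.step (registers W s) := by
  induction m generalizing s with
  | zero => exact ⟨s, by simp, rfl, rfl⟩
  | succ m ih =>
    set s₁ := execAll (absorb V g W) ({ s.1 with sym := f m }, s.2) with hs₁
    have hread : execAll (readSym V g k ρ W)
        (joint (n, Function.update τ 0 (shift ((m + 1 : ℕ) - 1) f)) s) =
        joint (n, Function.update τ 0 (shift (m - 1) f)) s₁ := by
      rw [readSym, execAll_cons, fetch_exec, execAll_map_onSnd, shift_shift, shift_apply_zero]
      simp [hs₁, sub_eq_neg_add]
    obtain ⟨s', h, hinput, hreg⟩ := ih s₁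
    refine ⟨s', ?_, ?_, ?_⟩
    · rw [List.replicate_succ, List.flatten_cons, execAll_append, hread, h]
    · rw [hinput, hs₁, execAll_absorb_input]
    · rw [hreg, hs₁, registers_absorb, List.range_succ, List.map_append, List.foldr_append]
      rfl

/-- The symbol in cell `j` of the input of the simulated machine if cell `j` of the input is `a`,
and the conditional probability of the symbol with number `t` is to be computed. -/
def queryCell (t : ℕ) (j : ℤ) (a : Sym V g) : Sym V g :=
  if 0 ≤ j ∧ j < t then a
  else if j = t then
    match a with
    | .blank => .eos
    | a => a
  else .blank

/-- The transducer step that prepares cell `j` of the tapes of the simulated machine. -/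
def loadStep (t : ℕ) (j : ℤ) (c : ρ × Ctl V g) (r : WorkTape ⊕ Fin (k + 1) → Sym V g) :
    (ρ × Ctl V g) × (WorkTape ⊕ Fin (k + 1) → Sym V g) :=
  (c, Sum.elim (r ∘ Sum.inl) fun i => if i = 0 then queryCell t j (r (.inl .input)) else .blank)

/-- The tapes that are accessed when the simulated machine is prepared. -/
def loadTapes (k : ℕ) : Set (WorkTape ⊕ Fin (k + 1)) :=
  insert (.inl .input) (Set.range Sum.inr)

/-- The program that prepares the simulated machine for the computation of the conditional
probability of the symbol with number `t`, if its tapes are blank at distance more than `B` from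
the heads. -/
def load (V : Type*) (g k : ℕ) (n₀ : ρ) (B t : ℕ) : List (MulInstr V g k ρ) :=
  setCtl (fun c => (n₀, c.2)) :: scan (loadTapes k) B (loadStep t)

lemma execAll_load {B t : ℕ} (htB : t ≤ B) (n n₀ : ρ) {τ : Fin (k + 1) → ℤ → Sym V g}
    (hτ : ∀ i, BlankBeyond B (τ i)) (s : Store (Ctl V g) WorkTape (Sym V g)) :
    execAll (load V g k n₀ B t) (joint (n, τ) s) =
      joint (n₀, fun i j => if i = 0 then queryCell t j (s.2 .input j) else .blank) s := by
  have hset : (setCtl (fun c : ρ × Ctl V g => (n₀, c.2))).exec (joint (n, τ) s) =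
    joint (n₀, τ) s := setCtl_exec _ _
  rw [load, execAll_cons, hset, execAll_scan _ _ fun _ _ _ => rfl]
  refine Prod.ext rfl (funext ?_)
  rintro (i | i)
  · by_cases hi : i = .input
    · subst hi
      simp [joint, loadTapes, loadStep]
    · simp [joint, loadTapes, hi]
  · funext j
    rcases le_or_gt |j| B with hj | hj
    · simp [joint, loadTapes, loadStep, hj]
    · have hq : queryCell t j (s.2 .input j) = .blank := by
        rw [lt_abs] at hj
        unfold queryCell
        rw [if_neg (by omega), if_neg (by omega)]
      have hτj : τ i j = .blank := hτ i j hj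
      simp [joint, loadTapes, hj.not_ge, hτj, hq]

/-- The query for the conditional probability of the symbol with number `t` of the string `x`
followed by the end-of-string symbol. -/
def query (g : ℕ) (x : List V) (t : ℕ) : List (Sym V g) :=
  strWord g (x.take t) ++ [nextSym g x[t]?]

lemma length_query {x : List V} {t : ℕ} (ht : t ≤ x.length) : (query g x t).length = t + 1 := by
  simp [query, strWord, ht]

lemma queryCell_wordTape {x : List V} {t : ℕ} (ht : t ≤ x.length) (j : ℤ) :
    queryCell t j (wordTape (strWord g x) j) = wordTape (query g x t) j := by
  unfold queryCell query
  rcases lt_or_ge j 0 with hj | hj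
  · rw [if_neg (by omega), if_neg (by omega), wordTape_of_neg _ hj]
    rfl
  lift j to ℕ using hj
  rw [wordTape_natCast, wordTape_natCast]
  have hlen : (strWord g (x.take t)).length = t := by simpa [strWord] using ht
  have hlen' : (strWord g x).length = x.length := by simp [strWord]
  rcases lt_trichotomy j t with hjt | rfl | hjt
  · rw [if_pos (by omega), List.getI_append _ _ _ (by omega),
      List.getI_eq_getElem _ (by omega), List.getI_eq_getElem _ (by omega)]
    simp only [strWord, List.getElem_map, List.getElem_take]
  · rw [if_neg (by omega), if_pos rfl, List.getI_append_right _ _ _ (by omega), hlen, Nat.sub_self]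
    rcases ht.lt_or_eq with hlt | rfl
    · rw [List.getI_eq_getElem _ (by omega), List.getElem?_eq_getElem hlt]
      simp only [strWord, List.getElem_map]
      rfl
    · rw [List.getI_eq_default _ (by omega), List.getElem?_eq_none le_rfl]
      rfl
  · rw [if_neg (by omega), if_neg (by omega),
      List.getI_eq_default _ (by rw [List.length_append, hlen]; exact hjt)]
    rfl

/-- The program that multiplies the fraction in the registers by the conditional probability of
the symbol with number `t` of the input: it runs `a` for `T` steps on that query, and then reads
the `L + 1` symbols on its output tape from right to left. -/
def round (a : Instr ρ (Fin (k + 1)) (Sym V g)) (n₀ : ρ) (L T W t : ℕ) :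
    List (MulInstr V g k ρ) :=
  load V g k n₀ (L + 1) t ++ List.replicate T a.onFst ++
    List.replicate L (moveHeads {.inr 0} Dir.right) ++
    (List.replicate (L + 1) (readSym V g k ρ W)).flatten ++ (complete V g W).map Instr.onSnd

@[simp] lemma length_absorb (W : ℕ) : (absorb V g W).length = 2 * W + 2 := by
  simp only [absorb, List.length_append, List.length_cons, List.length_nil, length_pass]
  omega

lemma length_round (a : Instr ρ (Fin (k + 1)) (Sym V g)) (n₀ : ρ) (L T W t : ℕ) :
    (round a n₀ L T W t).length =
      6 * (L + 1) + 3 + T + L + (L + 2) * (2 * W + 3) := by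
  simp only [round, load, readSym, complete, List.length_append, List.length_cons, List.length_map,
    List.length_replicate, List.length_flatten, List.map_replicate, List.sum_replicate, smul_eq_mul,
    length_scan, length_absorb]
  ring

lemma moveHeads_exec_joint (m : ℕ) (s : Store ρ (Fin (k + 1)) (Sym V g))
    (s' : Store (Ctl V g) WorkTape (Sym V g)) :
    (moveHeads {.inr 0} Dir.right).exec^[m] (joint s s') =
      joint (s.1, Function.update s.2 0 (shift m (s.2 0))) s' := by
  rw [moveHeads_exec_iterate, Set.piecewise_singleton, joint, Sum.update_elim_inr, moveOffset,
    mul_one]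
  rfl

lemma execAll_round {a : Instr ρ (Fin (k + 1)) (Sym V g)} {n₀ : ρ} {L T t : ℕ} (W : ℕ)
    {x : List V} (ht : t ≤ x.length) (hL : x.length + 1 + T ≤ L)
    {s : Store ρ (Fin (k + 1)) (Sym V g)} (hs : ∀ i, BlankBeyond (L + 1) (s.2 i))
    {s' : Store (Ctl V g) WorkTape (Sym V g)} (hs' : s'.2 .input = wordTape (strWord g x)) :
    let out := (a.exec^[T] (n₀, inputTapes 0 (query g x t))).2 0
    ∃ (s₁ : Store ρ (Fin (k + 1)) (Sym V g)) (s₁' : Store (Ctl V g) WorkTape (Sym V g)),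
      execAll (round a n₀ L T W t) (joint s s') = joint s₁ s₁' ∧
      (∀ i, BlankBeyond (L + 1) (s₁.2 i)) ∧ s₁'.2 .input = wordTape (strWord g x) ∧
      registers W s₁' = (Sym.eos :: (List.range (L + 1)).map fun j : ℕ => out j).foldr
        Registers.step (registers W s') := by
  intro out
  set s₀ := a.exec^[T] (n₀, inputTapes 0 (query g x t))
  have hload : execAll (load V g k n₀ (L + 1) t) (joint s s') =
      joint (n₀, inputTapes 0 (query g x t)) s' := by
    rw [execAll_load (by omega) s.1 n₀ hs, hs']
    simp only [queryCell_wordTape ht]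
    congr 2
    funext i j
    by_cases hi : i = 0
    · simp only [inputTapes, hi, if_true]
    · simp only [inputTapes, hi, if_false, wordTape_nil]
      rfl
  have hblank (i : Fin (k + 1)) : BlankBeyond L (s₀.2 i) := by
    have hquery : (query g x t).length + T ≤ L := by
      rw [length_query ht]
      omega
    exact (a.blankBeyond_exec_iterate (s := (n₀, inputTapes 0 (query g x t)))
      (blankBeyond_inputTapes 0 (query g x t)) T i).mono hquery
  obtain ⟨s₂, hread, hinput, hreg⟩ :=
    execAll_readSym_replicate W s₀.1 s₀.2 (s₀.2 0) (L + 1) s'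
  refine ⟨(s₀.1, Function.update s₀.2 0 (shift (-1) (s₀.2 0))), execAll (complete V g W) s₂,
    ?_, fun i => ?_, ?_, ?_⟩
  · have hL : ((L + 1 : ℕ) : ℤ) - 1 = L := by simp
    simp only [round, execAll_append, hload, execAll_replicate]
    have hsim : a.onFst.exec^[T] (joint (n₀, inputTapes 0 (query g x t)) s') = joint s₀ s' := by
      rw [← execAll_replicate, ← List.map_replicate, execAll_map_onFst, execAll_replicate]
    rw [hsim, moveHeads_exec_joint, ← hL, hread, execAll_map_onSnd]
  · by_cases hi : i = 0
    · subst hi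
      simpa using (hblank 0).shift_neg_one
    · simpa [hi] using (hblank i).mono (Nat.le_succ L)
  · rw [complete, execAll_cons, setCtl_exec, execAll_absorb_input, hinput, hs']
  · rw [complete, execAll_cons, setCtl_exec, registers_absorb, List.foldr_cons, ← hreg]
    rfl

end Round

/-! ### The product of the conditional probabilities -/

/-- The registers hold a fraction with value `v`, whose numerator and denominator are at most
`2 ^ B`. If `v = 0`, nothing is known about the content of the register for the denominator. -/
def Registers.Represents {R : Type*} [CommSemiring R] (B : ℕ) (r : Registers R) (v : ℝ) : Prop :=
  r.pastBar = false ∧ r.res = 0 ∧ ∃ N D : ℕ, N ≤ 2 ^ B ∧ D ≤ 2 ^ B ∧ D ≠ 0 ∧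
    v = (N : ℝ) / (D : ℝ) ∧ r.num = N ∧ (v ≠ 0 → r.den = D)

section Represents

variable {V R : Type*} {g : ℕ} [CommSemiring R] {r : Registers R} {B L : ℕ} {v : ℝ}

namespace Registers

lemma Represents.foldr_step_of_eq_zero (h : r.Represents B v) (hv : v = 0) (w : List (Sym V g)) :
    ((Sym.eos :: w).foldr step r).Represents (B + L) 0 := by
  obtain ⟨-, hres, N, D, -, -, hD, hvND, hnum, -⟩ := h
  have hN : N = 0 := by simpa [hv, eq_comm, hD] using hvND
  obtain ⟨hnum', hres'⟩ := num_foldr_step_eq_zero (hnum.trans (by simp [hN])) hres w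
  refine ⟨rfl, rfl, 0, 1, Nat.zero_le _, Nat.one_le_two_pow, one_ne_zero, by simp, ?_, by simp⟩
  simp only [List.foldr_cons, step]
  split
  · simpa using hres' ‹_›
  · simpa using hnum'

lemma Represents.foldr_step_fraction (h : r.Represents B v) (hv : v ≠ 0) {a b : List Bool}
    (ha : a.length ≤ L) (hb : b.length ≤ L) (hb₀ : binVal b ≠ 0) (n : ℕ) :
    ((Sym.eos :: ((bitWord V g a ++ Sym.slash :: bitWord V g b) ++
      List.replicate n Sym.blank)).foldr step r).Represents (B + L)
        (v * (binVal a / binVal b)) := by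
  obtain ⟨hbar, hres, N, D, hN, hD, hD₀, hvND, hnum, hden⟩ := h
  have hr : r = ⟨false, N, D, 0⟩ := Registers.ext hbar hnum (hden hv) hres
  have hle {w : List Bool} {M : ℕ} (hw : w.length ≤ L) (hM : M ≤ 2 ^ B) :
      binVal w * M ≤ 2 ^ (B + L) := by
    rw [add_comm, pow_add]
    exact Nat.mul_le_mul ((binVal_lt w).le.trans (Nat.pow_le_pow_right two_pos hw)) hM
  rw [hr, Registers.foldr_step_fraction]
  refine ⟨rfl, rfl, binVal a * N, binVal b * D, hle ha hN, hle hb hD, mul_ne_zero hb₀ hD₀,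
    ?_, by push_cast; rfl, fun _ => by push_cast; rfl⟩
  rw [hvND]
  push_cast
  ring

end Registers

lemma map_range_getI {Γ : Type*} [Inhabited Γ] {w : List Γ} {m : ℕ} (h : w.length ≤ m) :
    ((List.range m).map fun j => w.getI j) = w ++ List.replicate (m - w.length) default := by
  refine List.ext_getElem (by simp [h]) fun j hj _ => ?_
  rw [List.getElem_map, List.getElem_range, List.getElem_append]
  split
  · exact List.getI_eq_getElem _ _
  · rw [List.getI_eq_default _ (by omega), List.getElem_replicate]

lemma Registers.Represents.foldr_step_output {k T : ℕ} {q : TM k (Sym V g)} {w : List (Sym V g)}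
    {c : ℝ} (h : r.Represents B v) (hv : v ≠ 0) (hq : OutputsRat q w c) (hT : q.HaltsWithin w T)
    (hL : w.length + T ≤ L) :
    ((Sym.eos :: (List.range (L + 1)).map fun j : ℕ =>
      (q.toInstr.exec^[T] (0, inputTapes 0 w)).2 0 j).foldr step r).Represents (B + L) (v * c) := by
  obtain ⟨a, b, hb, rfl, hout⟩ := hq
  have hout := hout.outputsWithin hT
  have hlen := hout.length_le (by simp [bitWord, or_imp, forall_and])
  simp only [(TM.outputsWithin_iff ..).1 hout |>.2]
  rw [map_range_getI (by omega)]
  simp only [bitWord, List.length_append, List.length_cons, List.length_map] at hlen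
  exact h.foldr_step_fraction hv (by omega) (by omega) hb _

end Represents

section Product

variable {V : Type*} {g k m : ℕ} [NeZero m]

lemma exists_execAll_rounds {q : TM k (Sym V g)} (hm : ∀ r ∈ q.rules, r.tgt < m) {x : List V}
    {v : ℕ → ℝ} {L T : ℕ} (hT : ∀ t ≤ x.length, q.HaltsWithin (query g x t) T)
    (hq : ∀ t ≤ x.length, v t ≠ 0 → OutputsRat q (query g x t) (v (t + 1) / v t))
    (hv : ∀ t ≤ x.length, v t = 0 → v (t + 1) = 0) (hL : x.length + 1 + T ≤ L) (W : ℕ)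
    {s : Store (Fin m) (Fin (k + 1)) (Sym V g)} (hs : ∀ i, BlankBeyond (L + 1) (s.2 i))
    {s' : Store (Ctl V g) WorkTape (Sym V g)} (hs' : s'.2 .input = wordTape (strWord g x))
    (hreg : (registers W s').Represents 0 (v 0)) {t : ℕ} (ht : t ≤ x.length + 1) :
    ∃ (s₁ : Store (Fin m) (Fin (k + 1)) (Sym V g)) (s₁' : Store (Ctl V g) WorkTape (Sym V g)),
      execAll ((List.range t).flatMap (round (q.toFinInstr m) 0 L T W)) (joint s s') =
        joint s₁ s₁' ∧
      (∀ i, BlankBeyond (L + 1) (s₁.2 i)) ∧ s₁'.2 .input = wordTape (strWord g x) ∧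
      (registers W s₁').Represents (t * L) (v t) := by
  induction t with
  | zero => exact ⟨s, s', rfl, hs, hs', by simpa using hreg⟩
  | succ t ih =>
    have htx : t ≤ x.length := by omega
    obtain ⟨s₁, s₁', hexec, hs₁, hs₁', hreg₁⟩ := ih (by omega)
    obtain ⟨s₂, s₂', hexec₂, hs₂, hs₂', hreg₂⟩ :=
      execAll_round (a := q.toFinInstr m) (n₀ := 0) W htx hL hs₁ hs₁'
    refine ⟨s₂, s₂', ?_, hs₂, hs₂', ?_⟩
    · rw [List.range_succ, List.flatMap_append, execAll_append, hexec, List.flatMap_singleton,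
        hexec₂]
    have hsim := congrArg Prod.snd
      (TM.toFinInstr_exec_iterate hm (0, inputTapes 0 (query g x t)) T)
    simp only [Prod.map_snd, Prod.map_apply, id, Fin.val_zero] at hsim
    rw [hreg₂, hsim, add_one_mul]
    by_cases hvt : v t = 0
    · rw [hv t htx hvt]
      exact hreg₁.foldr_step_of_eq_zero hvt _
    · rw [← mul_div_cancel₀ (v (t + 1)) hvt]
      exact hreg₁.foldr_step_output hvt (hq t htx hvt) (hT t htx)
        (by rw [length_query htx]; omega)

end Product

/-! ### The beginning and the end of the computation -/

section Output

variable {V : Type*} {g : ℕ}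

/-- The instruction that sets the registers for the numerator and the denominator to one. -/
def start (V : Type*) (g : ℕ) : Instr (Ctl V g) WorkTape (Sym V g) := fun c r =>
  (c, fun i => (if i = .num ∨ i = .den then .bit true else r i, none))

/-- The initial control data. -/
def Ctl.init (V : Type*) (g : ℕ) : Ctl V g :=
  ⟨.blank, false, 0, false⟩

lemma tapeVal_blank (W : ℕ) : tapeVal W (fun _ => (default : Sym V g)) = 0 := by
  have hblank : (default : Sym V g).isOne = false := rfl
  simp [tapeVal_eq_sum, hblank]

lemma tapeVal_one (W : ℕ) :
    (tapeVal W (writeMove (fun _ => default) (.bit true : Sym V g) none) : ZMod (2 ^ W)) = 1 := by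
  rcases W with _ | W
  · exact Subsingleton.elim (α := ZMod 1) _ _
  · have hhigh (j : ℕ) :
        writeMove (fun _ => default) (.bit true : Sym V g) none (j + 1) = default := by
      rw [writeMove, Function.update_of_ne (by simp only [moveOffset]; omega)]
    have hlow : writeMove (fun _ => default) (.bit true : Sym V g) none 0 = .bit true := rfl
    have hblank : (default : Sym V g).isOne = false := rfl
    rw [tapeVal_eq_sum, Finset.sum_range_succ']
    have hone : (.bit true : Sym V g).isOne = true := rfl
    simp [hhigh, hlow, hblank, hone]

lemma registers_start (W : ℕ) (w : List (Sym V g)) :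
    registers W ((start V g).exec (Ctl.init V g, inputTapes .input w)) = ⟨false, 1, 1, 0⟩ := by
  simp [registers, start, Instr.exec, inputTapes, tapeVal_one, writeMove_head, moveOffset,
    tapeVal_blank, Ctl.init]

lemma start_exec_input (s : Store (Ctl V g) WorkTape (Sym V g)) :
    ((start V g).exec s).2 .input = s.2 .input := by
  simp [start, Instr.exec, writeMove_head, moveOffset]

/-- The transducer step that detects a nonzero digit of the numerator. -/
def detectStep (c : Ctl V g) (r : WorkTape → Sym V g) : Ctl V g × (WorkTape → Sym V g) :=
  ({ c with nonzero := c.nonzero || (r .num).isOne }, r)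

/-- The transducer step that writes symbol `j` of the output, if the tape `den` is offset by
`W + 1`. -/
def outputStep (W j : ℕ) (c : Ctl V g) (r : WorkTape → Sym V g) :
    Ctl V g × (WorkTape → Sym V g) :=
  (c, Function.update r .input <|
    if j < W then .bit (r .num).isOne
    else if j = W then .slash
    else .bit (!c.nonzero || (r .den).isOne))

/-- The program that writes the fraction in the registers of `W` digits on the tape `input`. If
the numerator is zero, then the denominator may be zero too, and is replaced by `2 ^ W - 1`. -/
def output (V : Type*) (g W : ℕ) : List (Instr (Ctl V g) WorkTape (Sym V g)) :=
  setCtl (fun c => { c with nonzero := false }) :: pass {.num} W (fun _ => detectStep) ++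
    List.replicate (W + 1) (moveHeads {.den} Dir.left) ++ pass {.res}ᶜ (2 * W + 1) (outputStep W)

@[simp] lemma length_output (W : ℕ) : (output V g W).length = 7 * W + 4 := by
  simp only [output, List.length_append, List.length_cons, List.length_replicate, length_pass]
  omega

/-- The digits of the denominator that the program `output` writes. -/
def outputDen (W : ℕ) (s : Store (Ctl V g) WorkTape (Sym V g)) : List Bool :=
  (List.range W).map fun j : ℕ => tapeVal W (s.2 .num) = 0 || (s.2 .den j).isOne

lemma nonzero_passCtl_detectStep (s : Store (Ctl V g) WorkTape (Sym V g)) (n : ℕ) :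
    (passCtl {.num} (fun _ => detectStep) s n).nonzero =
      (s.1.nonzero || (tapeDigits n (s.2 .num)).any id) := by
  induction n with
  | zero => simp [passCtl, tapeDigits]
  | succ n ih =>
    rw [passCtl, detectStep, ih, tapeDigits, tapeDigits, List.range_succ, List.map_append,
      List.any_append, Bool.or_assoc]
    simp [scanned]

lemma execAll_detect (W : ℕ) (s : Store (Ctl V g) WorkTape (Sym V g)) :
    ∃ c : Ctl V g, c.nonzero = decide (tapeVal W (s.2 .num) ≠ 0) ∧
      execAll (setCtl (fun c => { c with nonzero := false }) ::
        pass {.num} W fun _ => detectStep) s = (c, s.2) := by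
  refine ⟨_, ?_, Prod.ext rfl ?_⟩
  · rw [execAll_cons, setCtl_exec, execAll_pass, nonzero_passCtl_detectStep, Bool.false_or]
    refine Bool.eq_iff_iff.2 ?_
    rw [decide_eq_true_iff, tapeVal, ne_eq, binVal_eq_zero_iff, Bool.not_eq_false]
  · rw [execAll_cons, setCtl_exec, execAll_pass, Set.piecewise_singleton]
    refine (Function.update_eq_self_iff ..).2 (funext fun j => ?_)
    simp only [overwrite, detectStep, scanned, Set.mem_singleton_iff, if_true]
    split <;> simp_all

lemma execAll_output_input (W : ℕ) (s : Store (Ctl V g) WorkTape (Sym V g)) :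
    (execAll (output V g W) s).2 .input = overwrite (2 * W + 1)
      (fun j => if j < W then .bit (s.2 .num j).isOne
        else if j = W then .slash
        else .bit (tapeVal W (s.2 .num) = 0 || (s.2 .den (j - (W + 1))).isOne))
      (s.2 .input) := by
  obtain ⟨c, hc, hdetect⟩ := execAll_detect W s
  have hctl (s₁ : Store (Ctl V g) WorkTape (Sym V g)) (j : ℕ) :
      passCtl {.res}ᶜ (outputStep W) s₁ j = s₁.1 :=
    passCtl_invariant (f := id) (fun _ _ _ => rfl) j
  rw [output, execAll_append, execAll_append, hdetect, execAll_replicate, moveHeads_exec_iterate,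
    execAll_pass]
  simp only [hctl, outputStep, Set.piecewise_singleton, Set.mem_compl_iff, Set.mem_singleton_iff,
    reduceCtorEq, not_false_eq_true, Set.piecewise_eq_of_mem, Function.update_self]
  simp [scanned, hc, shift, moveOffset, sub_eq_add_neg, add_comm]

lemma execAll_output {W : ℕ} {s : Store (Ctl V g) WorkTape (Sym V g)}
    (hs : ∀ j : ℕ, 2 * W + 1 ≤ j → s.2 .input j = default) (j : ℕ) :
    (execAll (output V g W) s).2 .input j =
      (bitWord V g (tapeDigits W (s.2 .num)) ++
        Sym.slash :: bitWord V g (outputDen W s)).getI j := by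
  rw [execAll_output_input]
  rcases lt_or_ge j (2 * W + 1) with hj | hj
  · rw [overwrite_natCast_of_lt hj]
    rcases lt_trichotomy j W with hjW | rfl | hjW
    · rw [if_pos hjW, List.getI_append _ _ _ (by simpa [bitWord]),
        List.getI_eq_getElem _ (by simpa [bitWord])]
      simp [bitWord, tapeDigits]
    · rw [if_neg (lt_irrefl _), if_pos rfl, List.getI_append_right _ _ _ (by simp [bitWord])]
      simp [bitWord]
    · obtain ⟨i, rfl⟩ := Nat.exists_eq_add_of_le hjW
      have hindex : W + 1 + i - W = i + 1 := by omega
      rw [if_neg (by omega), if_neg (by omega),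
        List.getI_append_right _ _ _ (by simp [bitWord]; omega)]
      simp only [bitWord, List.length_map, length_tapeDigits, hindex, List.getI_cons_succ]
      rw [List.getI_eq_getElem _ (by simp [outputDen]; omega)]
      simp [outputDen]
  · rw [overwrite_natCast_of_le hj, hs j hj,
      List.getI_eq_default _ (by simp [bitWord, outputDen]; omega)]

lemma Registers.Represents.binVal_outputDen {B W : ℕ} {v : ℝ}
    {s : Store (Ctl V g) WorkTape (Sym V g)} (h : (registers W s).Represents B v) (hBW : B < W) :
    binVal (outputDen W s) ≠ 0 ∧ v = binVal (tapeDigits W (s.2 .num)) / binVal (outputDen W s) := by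
  obtain ⟨-, -, N, D, hN, hD, hD₀, hv, hnum, hden⟩ := h
  have eq_of_cast {t : WorkTape} {M : ℕ} (hM : M ≤ 2 ^ B)
      (ht : (tapeVal W (s.2 t) : ZMod (2 ^ W)) = M) : tapeVal W (s.2 t) = M :=
    Nat.ModEq.eq_of_lt_of_lt ((ZMod.natCast_eq_natCast_iff ..).1 ht) (tapeVal_lt W _)
      (hM.trans_lt (Nat.pow_lt_pow_right one_lt_two hBW))
  have hnum : tapeVal W (s.2 .num) = N := eq_of_cast hN hnum
  have hnum' : binVal (tapeDigits W (s.2 .num)) = N := hnum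
  rw [hnum']
  rcases eq_or_ne v 0 with rfl | hv₀
  · have hN : N = 0 := by simpa [hD₀, eq_comm] using hv
    have hones : outputDen W s = List.replicate W true := by simp [outputDen, hnum, hN]
    rw [hones, hN, ne_eq, binVal_eq_zero_iff]
    exact ⟨by simp; omega, by simp⟩
  · have hden : binVal (tapeDigits W (s.2 .den)) = D := eq_of_cast hD (hden hv₀)
    have hN : N ≠ 0 := by rintro rfl; simp [hv] at hv₀
    have hdigits : outputDen W s = tapeDigits W (s.2 .den) := by
      simp [outputDen, hnum, hN, tapeDigits]
    rw [hdigits, hden]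
    exact ⟨hD₀, hv⟩

end Output

/-! ### The multiplying machine -/

section Multiplier

variable {V : Type*} {g k : ℕ} {ρ : Type*}

/-- A bound for the length of the output of a machine that runs for `T` steps on a query after a
prefix of length at most `n`. -/
def outputRange (n T : ℕ) : ℕ :=
  n + 1 + T

/-- The number of digits of the registers. It allows for one bit more than the products of `n + 1`
numerals of `outputRange n T` bits. -/
def registerWidth (n T : ℕ) : ℕ :=
  (n + 1) * outputRange n T + 1

/-- The program that computes the product of the conditional probabilities of the symbols of a
string of length `n` followed by the end-of-string symbol, each of which `a` computes from the
initial state `n₀` in time `T`. -/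
def multiplier (a : Instr ρ (Fin (k + 1)) (Sym V g)) (n₀ : ρ) (n T : ℕ) :
    List (MulInstr V g k ρ) :=
  (start V g).onSnd :: (List.range (n + 1)).flatMap
    (round a n₀ (outputRange n T) T (registerWidth n T)) ++
    (output V g (registerWidth n T)).map Instr.onSnd

lemma length_multiplier (a : Instr ρ (Fin (k + 1)) (Sym V g)) (n₀ : ρ) (n T : ℕ) :
    (multiplier a n₀ n T).length =
      (n + 1) * (6 * (outputRange n T + 1) + 3 + T + outputRange n T +
        (outputRange n T + 2) * (2 * registerWidth n T + 3)) + (7 * registerWidth n T + 5) := by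
  simp only [multiplier, List.length_append, List.length_cons, List.length_flatMap, length_round,
    List.map_const', List.length_range, List.sum_replicate, smul_eq_mul, List.length_map,
    length_output]
  ring

lemma inputTapes_inl {κ ι Γ : Type*} [DecidableEq κ] [DecidableEq ι] [Inhabited Γ] (i₀ : ι)
    (w : List Γ) :
    (inputTapes (.inl i₀) w : ι ⊕ κ → ℤ → Γ) =
      Sum.elim (inputTapes i₀ w) fun _ => wordTape [] := by
  funext i
  rcases i with i | i <;> simp [inputTapes]

lemma exists_execAll_multiplier {m : ℕ} [NeZero m] {q : TM k (Sym V g)}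
    (hm : ∀ r ∈ q.rules, r.tgt < m) {x : List V} {v : ℕ → ℝ} {T : ℕ}
    (hT : ∀ t ≤ x.length, q.HaltsWithin (query g x t) T) (hv₀ : v 0 = 1)
    (hq : ∀ t ≤ x.length, v t ≠ 0 → OutputsRat q (query g x t) (v (t + 1) / v t))
    (hv : ∀ t ≤ x.length, v t = 0 → v (t + 1) = 0) :
    ∃ a b : List Bool, binVal b ≠ 0 ∧ v (x.length + 1) = binVal a / binVal b ∧
      ∀ j : ℕ, (execAll (multiplier (q.toFinInstr m) 0 x.length T)
        ((0, Ctl.init V g), inputTapes (.inl .input) (strWord g x))).2 (.inl .input) j =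
          (bitWord V g a ++ Sym.slash :: bitWord V g b).getI j := by
  set W := registerWidth x.length T with hW
  have hstart : (start V g).onSnd.exec
      ((0, Ctl.init V g), inputTapes (.inl .input) (strWord g x)) =
      joint ((0 : Fin m), fun _ : Fin (k + 1) => wordTape [])
        ((start V g).exec (Ctl.init V g, inputTapes .input (strWord g x))) := by
    rw [inputTapes_inl, ← onSnd_exec]
    rfl
  obtain ⟨s, s', hrounds, -, hinput, hreg⟩ := exists_execAll_rounds hm hT hq hv
    (L := outputRange x.length T) le_rfl W (s := (0, fun _ => wordTape []))
    (s' := (start V g).exec (Ctl.init V g, inputTapes .input (strWord g x)))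
    (fun _ => blankBeyond_wordTape (Nat.zero_le _))
    (by rw [start_exec_input]; simp [inputTapes])
    (by
      rw [registers_start, hv₀]
      exact ⟨rfl, rfl, 1, 1, le_rfl, le_rfl, one_ne_zero, by simp, by simp, by simp⟩)
    le_rfl
  obtain ⟨hb, hvb⟩ := hreg.binVal_outputDen (Nat.lt_succ_self _)
  refine ⟨_, _, hb, hvb, fun j => ?_⟩
  rw [multiplier, List.cons_append, execAll_cons, hstart, execAll_append, hrounds,
    execAll_map_onSnd]
  refine execAll_output (fun i hi => ?_) j
  rw [hinput, wordTape_natCast, List.getI_eq_default]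
  have : x.length + 1 ≤ W := by rw [hW, registerWidth, outputRange]; nlinarith
  simp only [strWord, List.length_map]
  omega

end Multiplier

/-! ### The chain rule -/

namespace WeightedLanguage

variable {V : Type*}

lemma prefixZ_nil (p : WeightedLanguage V) : p.prefixZ [] = p.Z :=
  (Equiv.subtypeUnivEquiv fun _ => List.nil_prefix).tsum_eq p

lemma prefixZ_eq_add_sum [Fintype V] {p : WeightedLanguage V} (hp : Summable p) (y : List V) :
    p.prefixZ y = p y + ∑ v, p.prefixZ (y ++ [v]) := by
  classical
  have hindicator (z : List V) : p.prefixZ z = ∑' x, {x | z <+: x}.indicator p x :=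
    tsum_subtype {x | z <+: x} p
  have hsummable (s : Set (List V)) : Summable (s.indicator p) :=
    NNReal.summable_of_le (fun x => Set.indicator_le_self s p x) hp
  have hsplit (x : List V) : {x | y <+: x}.indicator p x =
      ({y} : Set (List V)).indicator p x + ∑ v, {x | y ++ [v] <+: x}.indicator p x := by
    by_cases h : y <+: x
    · obtain ⟨z, rfl⟩ := h
      cases z with
      | nil =>
        have hlonger (v : V) : ¬ (y ++ [v] <+: y) := fun hv => by simpa using hv.length_le
        simp [hlonger]
      | cons w z => simp [Set.indicator_apply]
    · have hlonger (v : V) : ¬ (y ++ [v] <+: x) := fun hv =>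
        h ((List.prefix_append y [v]).trans hv)
      have hne : x ≠ y := by rintro rfl; exact h List.prefix_rfl
      simp [h, hlonger, hne]
  simp only [hindicator]
  rw [tsum_congr hsplit, Summable.tsum_add (hsummable _) (summable_sum fun v _ => hsummable _),
    Summable.tsum_finsetSum fun v _ => hsummable _]
  congr 1
  rw [tsum_eq_single y fun x hx => Set.indicator_of_notMem (by simpa using hx) _]
  simp

/-- The probability of the set of the strings that share with the string `x`, followed by the
end-of-string symbol, their first `t` symbols. -/
def chainProb (p : WeightedLanguage V) (x : List V) (t : ℕ) : ℝ :=
  (if t ≤ x.length then p.prefixZ (x.take t) else p x : ℝ≥0) / p.Z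

lemma chainProb_of_le (p : WeightedLanguage V) {x : List V} {t : ℕ} (ht : t ≤ x.length) :
    p.chainProb x t = p.prefixZ (x.take t) / p.Z := by
  rw [chainProb, if_pos ht]

lemma chainProb_zero {p : WeightedLanguage V} (hp : p.Normalizable) (x : List V) :
    p.chainProb x 0 = 1 := by
  rw [chainProb_of_le p (Nat.zero_le _), List.take_zero, prefixZ_nil,
    div_self (NNReal.coe_ne_zero.2 hp.2.ne')]

lemma chainProb_length_add_one (p : WeightedLanguage V) (x : List V) :
    p.chainProb x (x.length + 1) = p.normalized x := by
  rw [chainProb, if_neg (by omega), normalized, NNReal.coe_div]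

variable {p : WeightedLanguage V} {x : List V} {t : ℕ}

lemma prefixZ_take_pos (ht : t ≤ x.length) (h₀ : p.chainProb x t ≠ 0) :
    0 < p.prefixZ (x.take t) := by
  rw [chainProb_of_le p ht] at h₀
  exact pos_iff_ne_zero.2 (NNReal.coe_ne_zero.1 (left_ne_zero_of_mul h₀))

lemma chainProb_succ_eq_zero [Finite V] (hp : p.Normalizable) (ht : t ≤ x.length)
    (h₀ : p.chainProb x t = 0) : p.chainProb x (t + 1) = 0 := by
  cases nonempty_fintype V
  have hprefix : p.prefixZ (x.take t) = 0 := by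
    simpa [chainProb_of_le p ht, hp.2.ne'] using h₀
  have hsum := prefixZ_eq_add_sum hp.1 (x.take t)
  rw [hprefix, eq_comm, add_eq_zero, Finset.sum_eq_zero_iff] at hsum
  rcases ht.lt_or_eq with hlt | rfl
  · rw [chainProb_of_le p hlt, ← List.take_append_getElem hlt, hsum.2 _ (Finset.mem_univ _)]
    simp
  · rw [chainProb_length_add_one, normalized, ← List.take_length (l := x), hsum.1]
    simp

lemma localProb_take_getElem? [Fintype V] (hp : p.Normalizable) (ht : t ≤ x.length)
    (h₀ : p.chainProb x t ≠ 0) :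
    p.localProb (x.take t) x[t]? = p.chainProb x (t + 1) / p.chainProb x t := by
  have hZ : (p.Z : ℝ) ≠ 0 := NNReal.coe_ne_zero.2 hp.2.ne'
  rw [chainProb_of_le p ht] at h₀ ⊢
  rcases ht.lt_or_eq with hlt | rfl
  · rw [chainProb_of_le p hlt, div_div_div_cancel_right₀ hZ, List.getElem?_eq_getElem hlt,
      localProb, List.take_append_getElem hlt]
  · have hprefix : (p.prefixZ x : ℝ) ≠ 0 := by simpa using left_ne_zero_of_mul h₀
    have hsum := congrArg NNReal.toReal (prefixZ_eq_add_sum hp.1 x)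
    rw [chainProb_length_add_one, normalized, NNReal.coe_div, div_div_div_cancel_right₀ hZ,
      List.getElem?_length, List.take_length, localProb, ← Finset.sum_div, eq_div_iff hprefix,
      sub_mul, div_mul_cancel₀ _ hprefix, hsum]
    push_cast
    ring

end WeightedLanguage

/-! ### Efficiency -/

/-- The function is bounded by a polynomial. -/
def PolyBounded (f : ℕ → ℕ) : Prop :=
  ∃ P : Polynomial ℕ, ∀ n, f n ≤ P.eval n

namespace PolyBounded

variable {f f' : ℕ → ℕ}

lemma mono (h : PolyBounded f') (hle : ∀ n, f n ≤ f' n) : PolyBounded f :=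
  let ⟨P, hP⟩ := h
  ⟨P, fun n => (hle n).trans (hP n)⟩

lemma eval (P : Polynomial ℕ) : PolyBounded fun n => P.eval n :=
  ⟨P, fun _ => le_rfl⟩

lemma const (c : ℕ) : PolyBounded fun _ => c :=
  ⟨.C c, fun _ => by simp⟩

lemma id : PolyBounded fun n => n :=
  ⟨.X, fun _ => by simp⟩

lemma add (h : PolyBounded f) (h' : PolyBounded f') : PolyBounded fun n => f n + f' n :=
  let ⟨P, hP⟩ := h
  let ⟨Q, hQ⟩ := h'
  ⟨P + Q, fun n => by rw [Polynomial.eval_add]; exact Nat.add_le_add (hP n) (hQ n)⟩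

lemma mul (h : PolyBounded f) (h' : PolyBounded f') : PolyBounded fun n => f n * f' n :=
  let ⟨P, hP⟩ := h
  let ⟨Q, hQ⟩ := h'
  ⟨P * Q, fun n => by rw [Polynomial.eval_mul]; exact Nat.mul_le_mul (hP n) (hQ n)⟩

end PolyBounded

/-- The parametric model whose parameters are the descriptions of the specialized machines. -/
def copyModel (V : Type*) [Fintype V] (g k : ℕ) : ParametricModel V where
  numAux := g
  tapes := 0
  outTapes := k
  machine := compile (Equiv.refl _) [] ()

section Efficiency

variable {V : Type*} [Fintype V]

lemma copyModel_constructsWithin {g k : ℕ} (q : TM k (Sym V g)) :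
    (copyModel V g k).ConstructsWithin q.encode q 1 := by
  refine compile_outputsWithin (Equiv.refl (Fin (0 + 1))) rfl [] () fun j => ?_
  rw [execAll_nil]
  exact wordTape_natCast _ j

lemma ParametricModel.ConstructsWithin.encode_length_le {M : ParametricModel V} {θ : List Bool}
    {q : M.Specialized} {t : ℕ} (h : M.ConstructsWithin θ q t) :
    q.encode.length ≤ θ.length + t + 1 := by
  simpa [bitWord] using
    TM.OutputsWithin.length_le h (by simp [bitWord, or_imp, forall_and, default])

variable {g k l : ℕ} (e : WorkTape ⊕ Fin (k + 1) ≃ Fin (l + 1))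

/-- The machine that multiplies the conditional probabilities that `q` computes in time `T`, for
strings of length `n`. -/
def multiplierTM (q : TM k (Sym V g)) (n T : ℕ) : TM l (Sym V g) :=
  compile e (multiplier (q.toFinInstr (q.encode.length + 1)) 0 n T) (0, Ctl.init V g)

/-- The running time of the machine `multiplierTM`. -/
def multiplierTime (n T : ℕ) : ℕ :=
  (n + 1) * (6 * (outputRange n T + 1) + 3 + T + outputRange n T +
    (outputRange n T + 2) * (2 * registerWidth n T + 3)) + (7 * registerWidth n T + 6)

variable {e}

lemma multiplierTM_outputsRat (he : e (.inl .input) = 0) {p : WeightedLanguage V}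
    (hp : p.Normalizable) {q : TM k (Sym V g)} {x : List V} {T : ℕ}
    (hq : ∀ (y : List V) (s : Option V), y.length ≤ x.length → 0 < p.prefixZ y →
      OutputsRat q (strWord g y ++ [nextSym g s]) (p.localProb y s))
    (hT : ∀ (y : List V) (s : Option V), y.length ≤ x.length →
      q.HaltsWithin (strWord g y ++ [nextSym g s]) T) :
    OutputsRat (multiplierTM e q x.length T) (strWord g x) (p.normalized x) ∧
      (multiplierTM e q x.length T).HaltsWithin (strWord g x) (multiplierTime x.length T) := by
  obtain ⟨a, b, hb, hab, hexec⟩ := exists_execAll_multiplier (m := q.encode.length + 1)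
    (fun r hr => (TM.tgt_lt_encode_length hr).trans (Nat.lt_succ_self _))
    (fun t _ => hT (x.take t) x[t]? (List.length_take_le' t x))
    (WeightedLanguage.chainProb_zero hp x)
    (fun t ht h₀ => WeightedLanguage.localProb_take_getElem? hp ht h₀ ▸
      hq _ _ (List.length_take_le' t x) (WeightedLanguage.prefixZ_take_pos ht h₀))
    (fun t ht h₀ => WeightedLanguage.chainProb_succ_eq_zero hp ht h₀)
  have hout := compile_outputsWithin e he _ _ hexec
  rw [length_multiplier] at hout
  exact ⟨⟨a, b, hb, by rw [← hab, WeightedLanguage.chainProb_length_add_one], _, hout⟩, hout.1⟩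

lemma polyBounded_multiplierTime {T : ℕ → ℕ} (hT : PolyBounded T) :
    PolyBounded fun n => multiplierTime n (T n) := by
  have hn : PolyBounded fun n => n + 1 := PolyBounded.id.add (.const 1)
  have hL : PolyBounded fun n => outputRange n (T n) := hn.add hT
  have hW : PolyBounded fun n => registerWidth n (T n) := (hn.mul hL).add (.const 1)
  exact (hn.mul (((((PolyBounded.const 6).mul (hL.add (.const 1))).add (.const 3)).add hT).add hL
    |>.add ((hL.add (.const 2)).mul (((PolyBounded.const 2).mul hW).add (.const 3))))).add
      (((PolyBounded.const 7).mul hW).add (.const 6))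

lemma polyBounded_encode_multiplierTM {q : ℕ → TM k (Sym V g)} {T : ℕ → ℕ} (hT : PolyBounded T)
    (hq : PolyBounded fun n => (q n).encode.length) :
    PolyBounded fun n => (multiplierTM e (q n) n (T n)).encode.length := by
  have hlen : PolyBounded fun n =>
      (multiplier ((q n).toFinInstr ((q n).encode.length + 1)) 0 n (T n)).length :=
    (polyBounded_multiplierTime hT).mono fun n => by
      rw [length_multiplier, multiplierTime]
      omega
  have hcard : PolyBounded fun n =>
      Fintype.card (Fin ((q n).encode.length + 1) × Ctl V g) := by
    simp only [Fintype.card_prod, Fintype.card_fin]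
    exact (hq.add (.const 1)).mul (.const _)
  have hstates := hlen.mul hcard
  exact (((hstates.add (.const 1)).mul (.const _)).mul
    (((PolyBounded.const 2).mul ((PolyBounded.const 2).add hstates)).add (.const _))).mono
      fun n => compile_encode_length_le _ _ _

end Efficiency

end SeqModel

end

theorem lemma1 {V : Type*} [Fintype V] (p : SeqModel.WeightedLanguage V)
    (M : SeqModel.ParametricModel V) (θ : ℕ → List Bool)
    (h : M.EfficientlyLocallyNormalizes θ p) :
    SeqModel.EfficientlyComputableWithCompactParameters p.normalized := by
  obtain ⟨hp, q, hq, ⟨Pθ, hθ⟩, ⟨PC, hC⟩, ⟨PT, hT⟩⟩ := h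
  obtain ⟨k, e, he⟩ := SeqModel.exists_equiv_fin_apply_eq_zero
    (Sum.inl .input : SeqModel.WorkTape ⊕ Fin (M.outTapes + 1))
  have hlength : SeqModel.PolyBounded fun n => (q n).encode.length :=
    (((SeqModel.PolyBounded.eval Pθ).add (.eval PC)).add (.const 1)).mono fun n =>
      (hC n).encode_length_le.trans (by gcongr; exact hθ n)
  have hout (x : List V) :=
    SeqModel.multiplierTM_outputsRat he hp (x := x) (hq x.length) (hT x.length)
  obtain ⟨P, hP⟩ := SeqModel.polyBounded_multiplierTime (.eval PT)
  exact ⟨SeqModel.copyModel V M.numAux k,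
    fun n => (SeqModel.multiplierTM e (q n) n (PT.eval n)).encode,
    fun n => SeqModel.multiplierTM e (q n) n (PT.eval n),
    SeqModel.polyBounded_encode_multiplierTM (.eval PT) hlength,
    ⟨1, fun n => by rw [Polynomial.eval_one]; exact SeqModel.copyModel_constructsWithin _⟩,
    fun x => (hout x).1,
    P, fun x => (hout x).2.mono (hP x.length)⟩
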